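/- **Theorem 3.2 (Pfaffian Toda lattice).** Let $F:\mathbb R^2\to\mathbb C$ satisfy $F(y,x)=-F(x,y)$. For $t=(t_1,t_2,\dots)$, $s=(s_1,s_2,\dots)\in\mathbb C^\infty$ put $$\mu_{k\ell}(t,s)=\iint_{\mathbb R^2}x^k y^\ell\, e^{\sum_{i\ge1}(t_ix^i-s_iy^i)}F(x,y)\,dx\,dy ,$$ and let $\tilde\tau_{2k}(t)$ be the Pfaffian of the skew-symmetric matrix $(\mu_{ij}(t,-t))_{0\le i,j\le 2k-1}$ (normalized by $\tilde\tau_{2k}\,dx_0\wedge\dots\wedge dx_{2k-1}=\frac1{k!}(\sum_{i<j}\mu_{ij}\,dx_i\wedge dx_j)^k$, $\tilde\tau_0=1$). Write $\tilde h_k=\tilde\tau_{2k+2}/\tilde\tau_{2k}$ and $\tilde h=\mathrm{diag}(\tilde h_0,\tilde h_0,\tilde h_1,\tilde h_1,\dots)$. Let $\tilde p_k(t,z)$ be the skew-orthogonal polynomials $$\tilde p_{2k}(t,z)=z^{2k}\frac{\tilde\tau_{2k}(t-[z^{-1}])}{\tilde\tau_{2k}(t)},\qquad \tilde p_{2k+1}(t,z)=\frac{\left(z+\frac{\partial}{\partial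 t_1}\right)z^{2k}\tilde\tau_{2k}(t-[z^{-1}])}{\tilde\tau_{2k}(t)},\qquad [\alpha]=\left(\alpha,\tfrac{\alpha^2}2,\tfrac{\alpha^3}3,\dots\right),$$ where the shift $t\mapsto t-[w]$ (and $-t\mapsto -t+[w]$) means that the weight is multiplied by $e^{-\sum_i w^i(x^i+y^i)/i}=(1-wx)(1-wy)$, so that $\tilde\tau_{2k}(t-[w])$ is a polynomial in $w$. Let $\tilde P$ be the semi-infinite matrix of their coefficients, $\tilde p_i(t,z)=\sum_j\tilde P_{ij}z^j$, let $\Lambda=(\delta_{i,j-1})_{i,j\ge0}$, and set $$\tilde L=\tilde P\Lambda\tilde P^{-1},\qquad L=\tilde h^{-1/2}\tilde L\,\tilde h^{1/2}.$$ Decompose semi-infinite matrices into $2\times2$ blocks, $A=A_-+A_0+A_+$ being the parts strictly below, on, and strictly above the block diagonal; let $J$ be block diagonal with all diagonal blocks $\begin{pmatrix}0&1\\-1&0\end{pmatrix}$, let $\tilde J=J\tilde h$, and let $A_d=\mathrm{diag}(a_{00}+a_{11},a_{00}+a_{11},a_{22}+a_{33},a_{22}+a_{33},\dots)$. Let $n\ge1$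 and let $t$ be such that $\tilde\tau_{2k}(t)\ne0$ for all $k\ge0$, and such that, at $(t',-t')$ for all $t'$ obtained from $t$ by small complex changes of $t_1$ and $t_n$, the series $\sum_i t'_i(x^i+y^i)$ converges for almost every $(x,y)$ with $F(x,y)\neq0$ and all the moment integrals converge absolutely. Then, at $t$, all entries of $\tilde L$ are differentiable in $t_n$ and $$\frac{\partial\tilde L}{\partial t_n}=\left[-(\tilde L^n)_- -\tilde J\,(\tilde L^n)_+^{\top}\,\tilde J^{-1},\ \tilde L\right];$$ likewise, for every choice of the square roots $\tilde h_k^{1/2}$ that is continuous in $t_n$ at $t$, all entries of $L$ are differentiable in $t_n$ at $t$ and $$\frac{\partial L}{\partial t_n}=\left[-\tfrac12(L^n)_d-(L^n)_-+J\,(L^n)_+^{\top}\,J,\ L\right].$$ -/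

import Mathlib

open Polynomial Filter Topology MeasureTheory

namespace PfaffToda

/-! ### Semi-infinite matrices and their 2 x 2 block structure -/

/-- Semi-infinite complex matrices, indexed by `0, 1, 2, ...`. -/
abbrev SMat := Matrix ℕ ℕ ℂ

/-- Product of semi-infinite matrices, `(A B) i j = ∑ k, A i k * B k j`.  The sum is finite
whenever the rows of `A` are finitely supported, as they are for all products used below. -/
noncomputable def matMul (A B : SMat) : SMat := fun i j => ∑ᶠ k, A i k * B k j

infixl:70 " ⋅ₘ " => matMul

/-- Powers for the product `⋅ₘ`. -/
noncomputable def matPow (A : SMat) : ℕ → SMat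
  | 0 => 1
  | n + 1 => matPow A n ⋅ₘ A

/-- The commutator `[A, B]`. -/
noncomputable def bracket (A B : SMat) : SMat := A ⋅ₘ B - B ⋅ₘ A

/-- The shift matrix `Λ = (δ_{i, j-1})`. -/
def shiftMat : SMat := fun i j => if j = i + 1 then 1 else 0

/-- The entries `i, j` lie in the block with position `(i / 2, j / 2)`.
`blockUpper A` is the part `A_+` of `A` in the blocks strictly above the block diagonal. -/
def blockUpper (A : SMat) : SMat := fun i j => if i / 2 < j / 2 then A i j else 0

/-- The part `A_-` of `A` in the blocks strictly below the block diagonal. -/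
def blockLower (A : SMat) : SMat := fun i j => if j / 2 < i / 2 then A i j else 0

/-- `A_d = diag (a₀₀ + a₁₁, a₀₀ + a₁₁, a₂₂ + a₃₃, a₂₂ + a₃₃, ...)`. -/
def blockTrace (A : SMat) : SMat :=
  Matrix.diagonal fun i =>
    A (2 * (i / 2)) (2 * (i / 2)) + A (2 * (i / 2) + 1) (2 * (i / 2) + 1)

/-- `diag (d₀, d₀, d₁, d₁, ...)`. -/
def doubleDiag (d : ℕ → ℂ) : SMat := Matrix.diagonal fun i => d (i / 2)

/-- The matrix `J`, block diagonal with blocks `(0, 1; -1, 0)`. -/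
def J : SMat := fun i j =>
  if i % 2 = 0 ∧ j = i + 1 then 1 else if i % 2 = 1 ∧ i = j + 1 then -1 else 0

/-- The inverse of a block lower triangular semi-infinite matrix.  For such matrices, cutting
down to the first `N` rows and columns, `N` even, is compatible with products, so the entries
of the inverse are those of the inverses of the finite truncations. -/
noncomputable def blockInv (A : SMat) : SMat := fun i j =>
  (Matrix.of fun a b : Fin (2 * (max (i / 2) (j / 2) + 1)) => A a b)⁻¹
    ⟨i, by omega⟩ ⟨j, by omega⟩

/-! ### Pfaffians -/

/-- The Pfaffian of a skew-symmetric matrix of size `2 n`, i.e. the coefficient of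
`dx₀ ∧ ... ∧ dx_{2n-1}` in `(1 / n!) (∑_{i < j} A i j dx_i ∧ dx_j) ^ n`, written out:
`(1 / (2 ^ n n!)) ∑_σ sign σ ∏_{i < n} A (σ (2 i)) (σ (2 i + 1))`. -/
noncomputable def pf {R : Type*} [CommRing R] [Algebra ℚ R] (n : ℕ)
    (A : Matrix (Fin (2 * n)) (Fin (2 * n)) R) : R :=
  (1 / (2 ^ n * (n.factorial : ℚ))) •
    ∑ σ : Equiv.Perm (Fin (2 * n)), (Equiv.Perm.sign σ : ℤ) •
      ∏ i : Fin n, A (σ ⟨2 * i, by omega⟩) (σ ⟨2 * i + 1, by omega⟩)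

/-! ### The inner product and the moments -/

/-- The times `t = (t₁, t₂, ...)`. -/
abbrev Times := ℕ+ → ℂ

/-- The deformed weight `e^{∑ (t_i x^i - s_i y^i)} F(x, y)`. -/
noncomputable def weight (F : ℝ → ℝ → ℂ) (t s : Times) (x y : ℝ) : ℂ :=
  Complex.exp (∑' i : ℕ+, (t i * (x : ℂ) ^ (i : ℕ) - s i * (y : ℂ) ^ (i : ℕ))) * F x y

/-- `⟨f, g⟩ = ∬ f(x) g(y) e^{∑ (t_i x^i - s_i y^i)} F(x, y) dx dy`. -/
noncomputable def innerProd (F : ℝ → ℝ → ℂ) (t s : Times) (f g : ℝ → ℂ) : ℂ :=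
  ∫ p : ℝ × ℝ, f p.1 * g p.2 * weight F t s p.1 p.2

/-- The moments `μ_{kl}(t, s) = ⟨x^k, y^l⟩`. -/
noncomputable def moment (F : ℝ → ℝ → ℂ) (t s : Times) (k l : ℕ) : ℂ :=
  innerProd F t s (fun x => (x : ℂ) ^ k) (fun y => (y : ℂ) ^ l)

/-- The inner product on polynomials makes sense at `(t, s)`: the series in the exponent
converges almost everywhere on the set where `F ≠ 0`, and all moment integrals converge
absolutely. -/
def Converges (F : ℝ → ℝ → ℂ) (t s : Times) : Prop :=
  (∀ᵐ p : ℝ × ℝ, F p.1 p.2 ≠ 0 →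
    Summable fun i : ℕ+ => t i * (p.1 : ℂ) ^ (i : ℕ) - s i * (p.2 : ℂ) ^ (i : ℕ)) ∧
  ∀ k l : ℕ, Integrable fun p : ℝ × ℝ =>
    (p.1 : ℂ) ^ k * (p.2 : ℂ) ^ l * weight F t s p.1 p.2

/-! ### Pfaffian tau functions and skew-orthogonal polynomials -/

/-- `τ̃_{2n}(t)`, the Pfaffian of `(μ_{ij}(t, -t))_{0 ≤ i, j < 2n}`. -/
noncomputable def tau (F : ℝ → ℝ → ℂ) (n : ℕ) (t : Times) : ℂ :=
  pf n (Matrix.of fun i j => moment F t (-t) i j)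

/-- `h̃_n = τ̃_{2n+2} / τ̃_{2n}`. -/
noncomputable def hTilde (F : ℝ → ℝ → ℂ) (n : ℕ) (t : Times) : ℂ :=
  tau F (n + 1) t / tau F n t

/-- For `[w] = (w, w²/2, w³/3, ...)` the shift `t ↦ t - [w]` multiplies `e^{∑ t_i x^i}` by
`e^{-∑ (w x)^i / i} = 1 - w x`. -/
theorem exp_sub_bracket (t : Times) (w x : ℂ) (hw : ‖w * x‖ < 1)
    (ht : Summable fun i : ℕ+ => t i * x ^ (i : ℕ)) :
    Complex.exp (∑' i : ℕ+, (t i - w ^ (i : ℕ) / (i : ℕ)) * x ^ (i : ℕ)) =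
      (1 - w * x) * Complex.exp (∑' i : ℕ+, t i * x ^ (i : ℕ)) := by
  have h1 : HasSum (fun i : ℕ+ => (w * x) ^ (i : ℕ) / ((i : ℕ) : ℂ))
      (-Complex.log (1 - w * x)) := by
    have h0 := Complex.hasSum_taylorSeries_neg_log hw
    rw [← hasSum_subtype_iff_of_support_subset (s := {n : ℕ | 0 < n})] at h0
    · exact h0
    · intro n hn
      rcases Nat.eq_zero_or_pos n with rfl | h
      · simp at hn
      · exact h
  have h2 : (1 - w * x) ≠ 0 := by
    intro h
    have : w * x = 1 := by linear_combination -h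
    simp [this] at hw
  have h3 := (ht.hasSum.sub h1).tsum_eq
  have h4 : (fun i : ℕ+ => (t i - w ^ (i : ℕ) / (i : ℕ)) * x ^ (i : ℕ)) =
      fun i : ℕ+ => t i * x ^ (i : ℕ) - (w * x) ^ (i : ℕ) / ((i : ℕ) : ℂ) := by
    funext i
    rw [mul_pow]
    ring
  rw [h4, h3, sub_neg_eq_add, Complex.exp_add, Complex.exp_log h2, mul_comm]

/-- `μ_{ij}(t - [w], -t + [w])` as a polynomial in `w`: by the previous identity, the shift
multiplies the weight by `(1 - w x) (1 - w y)`. -/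
noncomputable def momentShift (F : ℝ → ℝ → ℂ) (t : Times) (i j : ℕ) : ℂ[X] :=
  C (moment F t (-t) i j)
    - C (moment F t (-t) (i + 1) j + moment F t (-t) i (j + 1)) * X
    + C (moment F t (-t) (i + 1) (j + 1)) * X ^ 2

/-- `τ̃_{2n}(t - [w])` as a polynomial in `w` (of degree at most `2n`). -/
noncomputable def tauShift (F : ℝ → ℝ → ℂ) (n : ℕ) (t : Times) : ℂ[X] :=
  pf n (Matrix.of fun i j => momentShift F t i j)

/-- `z^{2n} τ̃_{2n}(t - [z⁻¹])` as a polynomial in `z`. -/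
noncomputable def numer (F : ℝ → ℝ → ℂ) (n : ℕ) (t : Times) : ℂ[X] :=
  (tauShift F n t).reflect (2 * n)

/-- `∂/∂t₁` of `z^{2n} τ̃_{2n}(t - [z⁻¹])`, taken coefficient by coefficient. -/
noncomputable def numerDeriv (F : ℝ → ℝ → ℂ) (n : ℕ) (t : Times) : ℂ[X] :=
  ∑ j ∈ Finset.range (2 * n + 1),
    C (deriv (fun a : ℂ => (numer F n (t + Pi.single 1 a)).coeff j) 0) * X ^ j

/-- The polynomials
`p̃_{2n}(t, z) = z^{2n} τ̃_{2n}(t - [z⁻¹]) / τ̃_{2n}(t)` and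
`p̃_{2n+1}(t, z) = (z + ∂/∂t₁) z^{2n} τ̃_{2n}(t - [z⁻¹]) / τ̃_{2n}(t)`. -/
noncomputable def pTilde (F : ℝ → ℝ → ℂ) (k : ℕ) (t : Times) : ℂ[X] :=
  if k % 2 = 0 then C (tau F (k / 2) t)⁻¹ * numer F (k / 2) t
  else C (tau F (k / 2) t)⁻¹ * (X * numer F (k / 2) t + numerDeriv F (k / 2) t)

/-! ### The matrices of the lattice -/

/-- The matrix `P̃` of coefficients, `P̃ χ(z) = p̃(z)` with `χ(z) = (1, z, z², ...)`. -/
noncomputable def PTilde (F : ℝ → ℝ → ℂ) (t : Times) : SMat := fun i j => (pTilde F i t).coeff j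

/-- `L̃ = P̃ Λ P̃⁻¹`. -/
noncomputable def LTilde (F : ℝ → ℝ → ℂ) (t : Times) : SMat :=
  PTilde F t ⋅ₘ shiftMat ⋅ₘ blockInv (PTilde F t)

/-- `J̃ = J h̃`. -/
noncomputable def JTilde (F : ℝ → ℝ → ℂ) (t : Times) : SMat :=
  J ⋅ₘ doubleDiag fun k => hTilde F k t

/-- `L = h̃^{-1/2} L̃ h̃^{1/2}`, where `r k` is a choice of square root of `h̃_k`. -/
noncomputable def LSym (F : ℝ → ℝ → ℂ) (r : ℕ → Times → ℂ) (t : Times) : SMat :=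
  doubleDiag (fun k => (r k t)⁻¹) ⋅ₘ LTilde F t ⋅ₘ doubleDiag (fun k => r k t)

end PfaffToda

open PfaffToda

/-! ### Pfaffians: congruence, normalization, degeneracy -/

namespace PfaffToda

/-! Let `M` be the matrix of moments at `(t, -t)`. The proof rests on its skew Borel decomposition
`P M Pᵀ = J h`, with `P` lower triangular and with identity diagonal blocks. Its rows are the monic
skew-orthogonal polynomials (`skewCoeff`): orthogonality to lower degrees kills the blocks off the
diagonal, skewness leaves one number `h_k` per block, and `pf_congruence` with `det P = 1`
identifies `h_k` as a ratio of consecutive Pfaffians (`gram_skewCoeff`).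

The polynomials built from tau functions are these rows (`PTilde_eq_skewCoeff`). Let `K` be the
matrix of multiplication by `z` modulo the polynomial in row `2n`. Multiplying the weight by `(1 - w
x)(1 - w y)` is a congruence of the moment matrix by `1 - w K`, so the shifted tau function is `τ
det (1 - w K)`, and `K` is a companion matrix whose characteristic polynomial is that row
(`numer_coeff`). The odd rows come from differentiating the orthogonality relations in `t₁`
(`pTilde_odd_coeff`).

For the flow, `∂M/∂t_n = Λⁿ M + M (Λⁿ)ᵀ`. Put `A = P' P⁻¹`, which is strictly block lower
triangular, and `B = P Λⁿ P⁻¹ = Lⁿ`. Differentiating `P M Pᵀ = J h` gives `(A + B) J h - ((A + B) J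
h)ᵀ = J h'`. The strictly lower blocks determine `A = -B₋ - J h B₊ᵀ (J h)⁻¹`; the diagonal blocks
give `h_k' = h_k (B_{2k,2k} + B_{2k+1,2k+1})` (`skewBorel_flow`). Since `L = P Λ P⁻¹`, the first
equation is `L' = [A, L]`. Conjugating by `h^{1/2}` adds the logarithmic derivative of `h^{-1/2}`,
which is the trace term of the second.

All Pfaffians are nonzero at `t`, but near `t` only finitely many are controlled at once. Statements
about nearby times are therefore made entry by entry, each entry depending on finitely many rows
(`dressedShift_congr`). -/

/-- The unnormalized Pfaffian sum of a matrix indexed by pairs. -/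
def pfSum {ι R : Type*} [Fintype ι] [DecidableEq ι] [CommRing R]
    (A : Matrix (ι × Fin 2) (ι × Fin 2) R) : R :=
  ∑ σ : Equiv.Perm (ι × Fin 2), (Equiv.Perm.sign σ : ℤ) • ∏ i : ι, A (σ (i, 0)) (σ (i, 1))

theorem prod_pairs {ι M : Type*} [Fintype ι] [CommMonoid M] (f : ι × Fin 2 → M) :
    ∏ a, f a = ∏ i, f (i, 0) * f (i, 1) := by
  rw [Fintype.prod_prod_type]
  simp

/-- Expanding every entry of `B A Bᵀ` turns the product over pairs into a sum over all maps `f` on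
the indices. The signed sum over `σ` is then the determinant of `B` with columns chosen by `f`: zero
if `f` repeats a column, and `sign f * det B` if `f` is a permutation. -/
theorem pfSum_congruence {ι R : Type*} [Fintype ι] [DecidableEq ι] [CommRing R]
    (B A : Matrix (ι × Fin 2) (ι × Fin 2) R) :
    pfSum (B * A * B.transpose) = B.det * pfSum A := by
  have h1 : ∀ σ : Equiv.Perm (ι × Fin 2),
      ∏ i : ι, (B * A * B.transpose) (σ (i, 0)) (σ (i, 1)) =
        ∑ f : ι × Fin 2 → ι × Fin 2, (∏ i : ι, A (f (i, 0)) (f (i, 1))) * ∏ a, B (σ a) (f a) := by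
    intro σ
    have h2 : ∀ i : ι, (B * A * B.transpose) (σ (i, 0)) (σ (i, 1)) =
        ∑ g : Fin 2 → ι × Fin 2, A (g 0) (g 1) * (B (σ (i, 0)) (g 0) * B (σ (i, 1)) (g 1)) := by
      intro i
      rw [← (finTwoArrowEquiv (ι × Fin 2)).symm.sum_comp, Fintype.sum_prod_type_right,
        Matrix.mul_apply]
      refine Finset.sum_congr rfl fun l _ => ?_
      rw [Matrix.mul_apply, Finset.sum_mul]
      refine Finset.sum_congr rfl fun k _ => ?_
      simp [finTwoArrowEquiv, Matrix.transpose_apply]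
      ring
    simp_rw [h2]
    rw [Finset.prod_univ_sum, Fintype.piFinset_univ,
      ← (Equiv.curry ι (Fin 2) (ι × Fin 2)).sum_comp]
    refine Finset.sum_congr rfl fun f _ => ?_
    rw [Finset.prod_mul_distrib, prod_pairs]
    simp [Function.curry]
  have h3 : pfSum (B * A * B.transpose) =
      ∑ f : ι × Fin 2 → ι × Fin 2, (∏ i : ι, A (f (i, 0)) (f (i, 1))) *
        (B.submatrix id f).det := by
    unfold pfSum
    simp_rw [h1, Finset.smul_sum]
    rw [Finset.sum_comm]
    refine Finset.sum_congr rfl fun f _ => ?_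
    rw [Matrix.det_apply, Finset.mul_sum]
    refine Finset.sum_congr rfl fun σ _ => ?_
    rw [mul_smul_comm]
    rfl
  have h4 : ∑ f : ι × Fin 2 → ι × Fin 2, (∏ i : ι, A (f (i, 0)) (f (i, 1))) *
        (B.submatrix id f).det = ∑ σ : Equiv.Perm (ι × Fin 2),
        (∏ i : ι, A (σ (i, 0)) (σ (i, 1))) * (B.submatrix id σ).det := by
    symm
    refine Finset.sum_of_injOn (fun σ : Equiv.Perm (ι × Fin 2) => (σ : ι × Fin 2 → ι × Fin 2))
      (fun σ _ τ _ h => DFunLike.coe_injective h) (by simp) ?_ (by simp)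
    intro f _ hf
    by_cases hinj : Function.Injective f
    · exact absurd
        ⟨Equiv.ofBijective f (Finite.injective_iff_bijective.mp hinj), by simp, rfl⟩ hf
    · simp only [Function.Injective, not_forall] at hinj
      obtain ⟨a, b, hab, hne⟩ := hinj
      rw [Matrix.det_zero_of_column_eq hne (by simp [hab]), mul_zero]
  rw [h3, h4, pfSum, Finset.mul_sum]
  refine Finset.sum_congr rfl fun σ _ => ?_
  rw [Matrix.det_permute']
  simp only [zsmul_eq_mul]
  ring

/-- The pairing `{0, ..., 2n - 1} ≃ {0, ..., n - 1} × {0, 1}`. -/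
def pairEquiv (n : ℕ) : Fin n × Fin 2 ≃ Fin (2 * n) :=
  finProdFinEquiv.trans (finCongr (mul_comm n 2))

theorem pairEquiv_zero (n : ℕ) (i : Fin n) : pairEquiv n (i, 0) = ⟨2 * i, by omega⟩ := by
  ext; simp [pairEquiv]

theorem pairEquiv_one (n : ℕ) (i : Fin n) : pairEquiv n (i, 1) = ⟨2 * i + 1, by omega⟩ := by
  ext; simp [pairEquiv]; omega

theorem pf_eq_pfSum {R : Type*} [CommRing R] [Algebra ℚ R] (n : ℕ)
    (A : Matrix (Fin (2 * n)) (Fin (2 * n)) R) :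
    pf n A = (1 / (2 ^ n * (n.factorial : ℚ))) •
      pfSum (A.submatrix (pairEquiv n) (pairEquiv n)) := by
  unfold pf pfSum
  congr 1
  rw [← (pairEquiv n).permCongr.sum_comp]
  refine Finset.sum_congr rfl fun σ _ => ?_
  rw [Equiv.Perm.sign_permCongr]
  congr 1
  refine Finset.prod_congr rfl fun i _ => ?_
  simp [Equiv.permCongr_apply, ← pairEquiv_zero, ← pairEquiv_one]

/-- `pf (B A Bᵀ) = det B * pf A`. -/
theorem pf_congruence {R : Type*} [CommRing R] [Algebra ℚ R] (n : ℕ)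
    (B A : Matrix (Fin (2 * n)) (Fin (2 * n)) R) :
    pf n (B * A * B.transpose) = B.det * pf n A := by
  rw [pf_eq_pfSum, pf_eq_pfSum, mul_smul_comm,
    ← Matrix.det_submatrix_equiv_self (pairEquiv n) B, ← pfSum_congruence,
    Matrix.transpose_submatrix, Matrix.submatrix_mul_equiv, Matrix.submatrix_mul_equiv]

theorem pf_eq_zero_of_row {R : Type*} [CommRing R] [Algebra ℚ R] (n : ℕ)
    (A : Matrix (Fin (2 * n)) (Fin (2 * n)) R) (a : Fin (2 * n)) (h : ∀ b, A a b = 0)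
    (h' : ∀ b, A b a = 0) : pf n A = 0 := by
  rw [pf_eq_pfSum, pfSum, Finset.sum_eq_zero, smul_zero]
  intro σ _
  obtain ⟨⟨i, e⟩, he⟩ := (σ.trans (pairEquiv n)).surjective a
  rw [Finset.prod_eq_zero (Finset.mem_univ i), smul_zero]
  simp only [Matrix.submatrix_apply]
  simp only [Equiv.trans_apply] at he
  fin_cases e
  · simp only [Fin.zero_eta] at he
    rw [he]; exact h _
  · simp only [Fin.mk_one] at he
    rw [he]; exact h' _

/-- A substitute for `pf ^ 2 = det`. If `v A = 0` with `v a ≠ 0`, congruence by the identity with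
row `a` replaced by `v` has determinant `v a` and produces a matrix whose row and column `a` vanish,
hence whose Pfaffian is zero. -/
theorem det_ne_zero_of_pf_ne_zero (n : ℕ) (A : Matrix (Fin (2 * n)) (Fin (2 * n)) ℂ)
    (hA : A.transpose = -A) (h : pf n A ≠ 0) : A.det ≠ 0 := by
  intro hdet
  obtain ⟨v, hv, hvA⟩ := Matrix.exists_vecMul_eq_zero_iff.mpr hdet
  obtain ⟨a, ha⟩ := Function.ne_iff.mp hv
  set B : Matrix (Fin (2 * n)) (Fin (2 * n)) ℂ := (1 : Matrix _ _ ℂ).updateRow a v with hB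
  have hBdet : B.det = v a := by
    have := Matrix.det_updateRow_sum (1 : Matrix (Fin (2 * n)) (Fin (2 * n)) ℂ) a v
    rw [Matrix.det_one, smul_eq_mul, mul_one] at this
    rw [← this, hB]
    congr 2
    ext b
    simp [Matrix.one_apply]
  have hrow : ∀ b, (B * A * B.transpose) a b = 0 := by
    intro b
    have : ∀ c, (B * A) a c = 0 := by
      intro c
      have := congrFun hvA c
      simpa [Matrix.mul_apply, hB, Matrix.vecMul, dotProduct] using this
    simp [Matrix.mul_apply (M := B * A), this]
  have hskew : (B * A * B.transpose).transpose = -(B * A * B.transpose) := by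
    simp [Matrix.transpose_mul, hA, Matrix.mul_assoc]
  have := pf_congruence n B A
  rw [pf_eq_zero_of_row n _ a hrow, hBdet] at this
  · exact (mul_ne_zero ha h) this.symm
  · intro b
    have := congrFun (congrFun hskew a) b
    simp only [Matrix.transpose_apply, Matrix.neg_apply, hrow, neg_zero] at this
    exact this

/-- The standard symplectic form on pairs. -/
def pairForm (ι : Type*) [DecidableEq ι] : Matrix (ι × Fin 2) (ι × Fin 2) ℂ := fun a b =>
  if a.1 = b.1 then (if a.2 = 0 ∧ b.2 = 1 then 1 else if a.2 = 1 ∧ b.2 = 0 then -1 else 0) else 0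

theorem pairForm_ne_zero {ι : Type*} [DecidableEq ι] {a b : ι × Fin 2} (h : pairForm ι a b ≠ 0) :
    a.1 = b.1 ∧ a.2 ≠ b.2 := by
  unfold pairForm at h
  split_ifs at h <;> simp_all

theorem pairForm_perm {ι : Type*} [DecidableEq ι] (i : ι) (p : Equiv.Perm (Fin 2)) :
    pairForm ι (i, p 0) (i, p 1) = ((Equiv.Perm.sign p : ℤ) : ℂ) := by
  have h : p = 1 ∨ p = Equiv.swap 0 1 := by decide +revert
  rcases h with rfl | rfl <;> simp [pairForm]

/-- A permutation contributes only if it maps pairs to pairs, that is, if it permutes the pairs and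
then possibly swaps inside each one. Permuting whole pairs is even, so the sign is the product of
the inner signs, which the entries of the form cancel. This leaves `n! 2 ^ n` terms equal to `1`. -/
theorem pfSum_pairForm (ι : Type*) [Fintype ι] [DecidableEq ι] :
    pfSum (pairForm ι) = 2 ^ Fintype.card ι * ((Fintype.card ι).factorial : ℂ) := by
  let Φ : Equiv.Perm ι × (ι → Equiv.Perm (Fin 2)) → Equiv.Perm (ι × Fin 2) := fun q =>
    Equiv.prodCongrLeft (fun _ => q.1) * Equiv.prodCongrRight q.2
  have hΦ : ∀ q i b, Φ q (i, b) = (q.1 i, q.2 i b) := fun q i b => rfl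
  have key : ∑ q : Equiv.Perm ι × (ι → Equiv.Perm (Fin 2)), (1 : ℂ) = pfSum (pairForm ι) := by
    refine Finset.sum_of_injOn Φ ?_ (by simp) ?_ ?_
    · intro q _ q' _ h
      have h' : ∀ i b, (q.1 i, q.2 i b) = (q'.1 i, q'.2 i b) := fun i b => by
        rw [← hΦ, ← hΦ, h]
      ext1
      · ext i; exact congrArg Prod.fst (h' i 0)
      · funext i; ext1 b; exact congrArg Prod.snd (h' i b)
    · intro σ _ hσ
      by_contra hne
      have hprod : ∀ i, pairForm ι (σ (i, 0)) (σ (i, 1)) ≠ 0 := fun i h0 => hne <| by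
        rw [Finset.prod_eq_zero (Finset.mem_univ i) h0, smul_zero]
      have h1 : ∀ i b, (σ (i, b)).1 = (σ (i, 0)).1 := by
        intro i b
        fin_cases b
        · rfl
        · exact (pairForm_ne_zero (hprod i)).1.symm
      -- If two pairs had the same image pair, its two positions would have to hold the images of
      -- three distinct indices.
      have hf : Function.Injective fun i => (σ (i, 0)).1 := by
        intro i j hij
        simp only at hij
        have h2 := (pairForm_ne_zero (hprod j)).2
        by_cases h3 : (σ (i, 0)).2 = (σ (j, 0)).2
        · exact congrArg Prod.fst (σ.injective (Prod.ext hij h3))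
        · have h4 : (σ (i, 0)).2 = (σ (j, 1)).2 := by omega
          exact congrArg Prod.fst (σ.injective (Prod.ext (hij.trans (h1 j 1).symm) h4))
      have hs : ∀ i, Function.Injective fun b => (σ (i, b)).2 := by
        intro i b c hbc
        exact congrArg Prod.snd (σ.injective (Prod.ext ((h1 i b).trans (h1 i c).symm) hbc))
      refine hσ ⟨(Equiv.ofBijective _ (Finite.injective_iff_bijective.mp hf),
        fun i => Equiv.ofBijective _ (Finite.injective_iff_bijective.mp (hs i))), by simp, ?_⟩
      ext1 ⟨i, b⟩
      rw [hΦ]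
      exact Prod.ext (h1 i b).symm rfl
    · intro q _
      have hsign : Equiv.Perm.sign (Φ q) = ∏ i, Equiv.Perm.sign (q.2 i) := by
        simp only [Φ, Equiv.Perm.sign_mul, Equiv.Perm.sign_prodCongrLeft,
          Equiv.Perm.sign_prodCongrRight]
        simp
      have h2 : ∀ i, pairForm ι (Φ q (i, 0)) (Φ q (i, 1)) =
          ((Equiv.Perm.sign (q.2 i) : ℤ) : ℂ) := fun i => by
        rw [hΦ, hΦ, pairForm_perm]
      simp_rw [h2, hsign]
      rw [zsmul_eq_mul, Units.coe_prod, Int.cast_prod, ← Finset.prod_mul_distrib]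
      symm
      refine Finset.prod_eq_one fun i _ => ?_
      rw [← Int.cast_mul, Int.units_coe_mul_self, Int.cast_one]
  rw [← key]
  simp [Fintype.card_perm, mul_comm]

theorem pf_J (n : ℕ) : pf n (Matrix.of fun i j : Fin (2 * n) => J i j) = 1 := by
  have h : (Matrix.of fun i j : Fin (2 * n) => J i j).submatrix (pairEquiv n) (pairEquiv n) =
      pairForm (Fin n) := by
    ext ⟨i, b⟩ ⟨j, c⟩
    fin_cases b <;> fin_cases c <;>
      simp [pairEquiv_zero, pairEquiv_one, J, pairForm, Fin.ext_iff] <;> grind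
  rw [pf_eq_pfSum, h, pfSum_pairForm, Fintype.card_fin, Algebra.smul_def]
  have : ((n.factorial : ℕ) : ℂ) ≠ 0 := by exact_mod_cast n.factorial_ne_zero
  simp
  field_simp

/-- The block diagonal matrix with blocks `(0, d k; -d k, 0)` has Pfaffian `∏ d k`. -/
theorem pf_J_mul (n : ℕ) (d : ℕ → ℂ) :
    pf n (Matrix.of fun i j : Fin (2 * n) => J i j * d (j / 2)) = ∏ k ∈ Finset.range n, d k := by
  set B : Matrix (Fin (2 * n)) (Fin (2 * n)) ℂ :=
    Matrix.diagonal fun i => if (i : ℕ) % 2 = 0 then d (i / 2) else 1 with hB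
  have h : (Matrix.of fun i j : Fin (2 * n) => J i j * d (j / 2)) =
      B * (Matrix.of fun i j : Fin (2 * n) => J i j) * B.transpose := by
    ext i j
    rw [hB, Matrix.diagonal_transpose, Matrix.mul_diagonal, Matrix.diagonal_mul]
    simp only [Matrix.of_apply, J]
    grind
  rw [h, pf_congruence, pf_J, mul_one, hB, Matrix.det_diagonal,
    ← (pairEquiv n).prod_comp, prod_pairs, ← Fin.prod_univ_eq_prod_range]
  refine Finset.prod_congr rfl fun i _ => ?_
  simp [pairEquiv_zero, pairEquiv_one]

/-! ### Calculus of row-finite semi-infinite matrices -/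

/-- All rows are finitely supported. -/
def RowFinite (A : SMat) : Prop := ∀ i, ∃ N, ∀ k, N ≤ k → A i k = 0

/-- The blocks strictly above the block diagonal vanish. -/
def BlockLower (A : SMat) : Prop := ∀ i j, i / 2 < j / 2 → A i j = 0

theorem BlockLower.rowFinite {A : SMat} (h : BlockLower A) : RowFinite A := fun i =>
  ⟨i + 2, fun k hk => h i k (by omega)⟩

theorem matMul_eq_sum {A : SMat} {i N : ℕ} (h : ∀ k, N ≤ k → A i k = 0) (B : SMat) (j : ℕ) :
    (A ⋅ₘ B) i j = ∑ k ∈ Finset.range N, A i k * B k j := by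
  refine finsum_eq_sum_of_support_subset _ fun k hk => ?_
  by_contra hk'
  simp only [Finset.coe_range, Set.mem_Iio, not_lt] at hk'
  exact hk (by simp [h k hk'])

theorem matMul_eq_single {A B : SMat} {i j : ℕ} (k : ℕ)
    (h : ∀ l, l ≠ k → A i l * B l j = 0) : (A ⋅ₘ B) i j = A i k * B k j :=
  finsum_eq_single _ k h

theorem matMul_transpose (A B : SMat) : (A ⋅ₘ B).transpose = B.transpose ⋅ₘ A.transpose := by
  ext i j
  simp only [Matrix.transpose_apply, matMul]
  exact finsum_congr fun k => mul_comm _ _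

theorem one_matMul (A : SMat) : (1 : SMat) ⋅ₘ A = A := by
  ext i j
  rw [matMul_eq_single i fun l hl => by simp [Matrix.one_apply_ne hl.symm]]
  simp

theorem matMul_one (A : SMat) : A ⋅ₘ (1 : SMat) = A := by
  ext i j
  rw [matMul_eq_single j fun l hl => by simp [Matrix.one_apply_ne hl]]
  simp

theorem rowFinite_one : RowFinite 1 := fun i =>
  ⟨i + 1, fun k hk => Matrix.one_apply_ne (by omega)⟩

theorem RowFinite.exists_uniform {A : SMat} (h : RowFinite A) (N : ℕ) :
    ∃ K, ∀ i, i < N → ∀ k, K ≤ k → A i k = 0 := by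
  choose f hf using h
  refine ⟨(Finset.range N).sup f, fun i hi k hk => hf i k ?_⟩
  exact (Finset.le_sup (f := f) (Finset.mem_range.mpr hi)).trans hk

theorem RowFinite.mul {A B : SMat} (hA : RowFinite A) (hB : RowFinite B) :
    RowFinite (A ⋅ₘ B) := by
  intro i
  obtain ⟨N, hN⟩ := hA i
  obtain ⟨K, hK⟩ := hB.exists_uniform N
  refine ⟨K, fun k hk => ?_⟩
  rw [matMul_eq_sum hN]
  exact Finset.sum_eq_zero fun l hl => by rw [hK l (Finset.mem_range.mp hl) k hk, mul_zero]

theorem RowFinite.matPow {A : SMat} (hA : RowFinite A) (n : ℕ) : RowFinite (matPow A n) := by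
  induction n with
  | zero => exact rowFinite_one
  | succ n ih => exact ih.mul hA

theorem matMul_assoc {A B : SMat} (hA : RowFinite A) (hB : RowFinite B) (C : SMat) :
    A ⋅ₘ B ⋅ₘ C = A ⋅ₘ (B ⋅ₘ C) := by
  ext i j
  obtain ⟨N, hN⟩ := hA i
  obtain ⟨K, hK⟩ := hB.exists_uniform N
  have hAB : ∀ k, K ≤ k → (A ⋅ₘ B) i k = 0 := fun k hk => by
    rw [matMul_eq_sum hN]
    exact Finset.sum_eq_zero fun l hl => by rw [hK l (Finset.mem_range.mp hl) k hk, mul_zero]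
  rw [matMul_eq_sum hAB, matMul_eq_sum hN]
  simp_rw [matMul_eq_sum hN, Finset.sum_mul]
  rw [Finset.sum_comm]
  refine Finset.sum_congr rfl fun l hl => ?_
  rw [matMul_eq_sum (hK l (Finset.mem_range.mp hl)), Finset.mul_sum]
  exact Finset.sum_congr rfl fun k _ => mul_assoc _ _ _

/-- The moment matrix is neither row-finite nor column-finite, so `P M Pᵀ` has to be reassociated
using finiteness of the outer factors alone. -/
theorem matMul_assoc' {A C : SMat} (hA : RowFinite A) (hC : RowFinite C.transpose) (B : SMat) :
    A ⋅ₘ B ⋅ₘ C = A ⋅ₘ (B ⋅ₘ C) := by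
  ext i j
  obtain ⟨N, hN⟩ := hA i
  obtain ⟨K, hK⟩ := hC j
  have hright : ∀ (X : SMat) (l : ℕ), (X ⋅ₘ C) l j = ∑ k ∈ Finset.range K, X l k * C k j := by
    intro X l
    rw [← Matrix.transpose_apply (X ⋅ₘ C), matMul_transpose, matMul_eq_sum hK]
    exact Finset.sum_congr rfl fun k _ => mul_comm _ _
  rw [hright, matMul_eq_sum hN]
  simp_rw [matMul_eq_sum hN, hright, Finset.sum_mul, Finset.mul_sum]
  rw [Finset.sum_comm]
  exact Finset.sum_congr rfl fun l _ => Finset.sum_congr rfl fun k _ => mul_assoc _ _ _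

theorem add_matMul {A B : SMat} (hA : RowFinite A) (hB : RowFinite B) (C : SMat) :
    (A + B) ⋅ₘ C = A ⋅ₘ C + B ⋅ₘ C := by
  ext i j
  obtain ⟨N, hN⟩ := hA i
  obtain ⟨K, hK⟩ := hB i
  have hN' : ∀ k, max N K ≤ k → A i k = 0 := fun k hk => hN k (by omega)
  have hK' : ∀ k, max N K ≤ k → B i k = 0 := fun k hk => hK k (by omega)
  rw [Matrix.add_apply, matMul_eq_sum hN', matMul_eq_sum hK',
    matMul_eq_sum (fun k hk => by rw [Matrix.add_apply, hN' k hk, hK' k hk, add_zero]),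
    ← Finset.sum_add_distrib]
  exact Finset.sum_congr rfl fun k _ => add_mul _ _ _

theorem matMul_add {A : SMat} (hA : RowFinite A) (B C : SMat) :
    A ⋅ₘ (B + C) = A ⋅ₘ B + A ⋅ₘ C := by
  ext i j
  obtain ⟨N, hN⟩ := hA i
  rw [Matrix.add_apply, matMul_eq_sum hN, matMul_eq_sum hN, matMul_eq_sum hN,
    ← Finset.sum_add_distrib]
  exact Finset.sum_congr rfl fun k _ => mul_add _ _ _

theorem matMul_neg (A B : SMat) : A ⋅ₘ (-B) = -(A ⋅ₘ B) := by
  ext i j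
  simp only [matMul, Matrix.neg_apply, mul_neg]
  exact finsum_neg_distrib _

/-! Truncations and inverses -/

/-- The first `N` rows and columns. -/
def trunc (N : ℕ) (A : SMat) : Matrix (Fin N) (Fin N) ℂ := Matrix.of fun a b => A a b

@[simp] theorem trunc_apply (N : ℕ) (A : SMat) (a b : Fin N) : trunc N A a b = A a b := rfl

theorem trunc_one (N : ℕ) : trunc N 1 = 1 := by
  ext a b
  simp [Matrix.one_apply, Fin.ext_iff]

theorem BlockLower.trunc_mul {A : SMat} (hA : BlockLower A) (B : SMat) (K : ℕ) :
    trunc (2 * K) (A ⋅ₘ B) = trunc (2 * K) A * trunc (2 * K) B := by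
  ext a b
  rw [trunc_apply, matMul_eq_sum (N := 2 * K) (fun k hk => hA _ _ (by omega)), Matrix.mul_apply,
    ← Fin.sum_univ_eq_sum_range (fun k => A a k * B k b)]
  rfl

theorem ext_trunc {A B : SMat} (h : ∀ K, trunc (2 * K) A = trunc (2 * K) B) : A = B := by
  ext i j
  exact congrFun (congrFun (h (i + j + 1)) ⟨i, by omega⟩) ⟨j, by omega⟩

theorem blockInv_apply (A : SMat) (i j : ℕ) : blockInv A i j =
    (trunc (2 * (max (i / 2) (j / 2) + 1)) A)⁻¹ ⟨i, by omega⟩ ⟨j, by omega⟩ := rfl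

theorem BlockLower.blockInv_eq {A B : SMat} (hA : BlockLower A) (h : A ⋅ₘ B = 1) :
    blockInv A = B := by
  ext i j
  rw [blockInv_apply, Matrix.inv_eq_right_inv (B := trunc _ B), trunc_apply]
  rw [← hA.trunc_mul, h, trunc_one]

/-- One-sided inverses of semi-infinite matrices need not be two-sided; block triangularity reduces
the claim to finite square truncations, where they are. -/
theorem BlockLower.matMul_eq_one_comm {A B : SMat} (hA : BlockLower A) (hB : BlockLower B)
    (h : A ⋅ₘ B = 1) : B ⋅ₘ A = 1 := by
  refine ext_trunc fun K => ?_
  rw [hB.trunc_mul, trunc_one, mul_eq_one_comm, ← hA.trunc_mul, h, trunc_one]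

theorem BlockLower.mul {A B : SMat} (hA : BlockLower A) (hB : BlockLower B) :
    BlockLower (A ⋅ₘ B) := by
  intro i j hij
  rw [matMul_eq_sum (N := 2 * (i / 2) + 2) (fun k hk => hA _ _ (by omega))]
  exact Finset.sum_eq_zero fun k hk => by
    rw [hB k j (by have := Finset.mem_range.mp hk; omega), mul_zero]

/-! The matrices `J` and `diag (d₀, d₀, d₁, d₁, ...)` -/

/-- The other index in the block of `i`. -/
def partner (i : ℕ) : ℕ := if i % 2 = 0 then i + 1 else i - 1

/-- The nonzero entry of row `i` of `J`. -/
def jSign (i : ℕ) : ℂ := if i % 2 = 0 then 1 else -1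

theorem partner_partner (i : ℕ) : partner (partner i) = i := by unfold partner; grind

theorem partner_div (i : ℕ) : partner i / 2 = i / 2 := by unfold partner; grind

theorem jSign_partner (i : ℕ) : jSign (partner i) = -jSign i := by
  unfold jSign partner
  grind

theorem jSign_mul_self (i : ℕ) : jSign i * jSign i = 1 := by unfold jSign; split_ifs <;> norm_num

theorem J_apply (i j : ℕ) : J i j = if j = partner i then jSign i else 0 := by
  unfold J partner jSign
  grind

theorem matMul_doubleDiag (A : SMat) (d : ℕ → ℂ) (i j : ℕ) :
    (A ⋅ₘ doubleDiag d) i j = A i j * d (j / 2) := by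
  rw [matMul_eq_single j fun l hl => by simp [doubleDiag, Matrix.diagonal_apply_ne _ hl]]
  simp [doubleDiag]

theorem doubleDiag_matMul (A : SMat) (d : ℕ → ℂ) (i j : ℕ) :
    (doubleDiag d ⋅ₘ A) i j = d (i / 2) * A i j := by
  rw [matMul_eq_single i fun l hl => by simp [doubleDiag, Matrix.diagonal_apply_ne _ hl.symm]]
  simp [doubleDiag]

/-- The block diagonal matrix with blocks `(0, d k; -d k, 0)`. -/
noncomputable def jDiag (d : ℕ → ℂ) : SMat := J ⋅ₘ doubleDiag d

theorem jDiag_apply (d : ℕ → ℂ) (i j : ℕ) :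
    jDiag d i j = if j = partner i then jSign i * d (i / 2) else 0 := by
  rw [jDiag, matMul_doubleDiag, J_apply]
  split_ifs with h
  · rw [h, partner_div]
  · rw [zero_mul]

theorem jDiag_one : jDiag (fun _ => 1) = J := by
  ext i j
  rw [jDiag, matMul_doubleDiag, mul_one]

theorem jDiag_matMul (d : ℕ → ℂ) (A : SMat) (i j : ℕ) :
    (jDiag d ⋅ₘ A) i j = jSign i * d (i / 2) * A (partner i) j := by
  rw [matMul_eq_single (partner i) fun l hl => by rw [jDiag_apply, if_neg hl, zero_mul],
    jDiag_apply, if_pos rfl]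

theorem matMul_jDiag (d : ℕ → ℂ) (A : SMat) (i j : ℕ) :
    (A ⋅ₘ jDiag d) i j = -(A i (partner j) * (jSign j * d (j / 2))) := by
  rw [matMul_eq_single (partner j) fun l hl => ?_, jDiag_apply, if_pos (partner_partner j).symm,
    partner_div, jSign_partner]
  · ring
  · rw [jDiag_apply, if_neg, mul_zero]
    rintro rfl
    exact hl (partner_partner l).symm

theorem blockLower_jDiag (d : ℕ → ℂ) : BlockLower (jDiag d) := by
  intro i j hij
  rw [jDiag_apply, if_neg]
  rintro rfl
  rw [partner_div] at hij
  omega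

theorem jDiag_transpose (d : ℕ → ℂ) : (jDiag d).transpose = -jDiag d := by
  ext i j
  rw [Matrix.transpose_apply, Matrix.neg_apply, jDiag_apply, jDiag_apply]
  by_cases h : j = partner i
  · rw [if_pos h, h, if_pos (partner_partner i).symm, jSign_partner, partner_div]
    ring
  · rw [if_neg h, if_neg, neg_zero]
    rintro rfl
    exact h (partner_partner j).symm

theorem jDiag_mul_inv (d : ℕ → ℂ) (hd : ∀ k, d k ≠ 0) :
    jDiag d ⋅ₘ (-jDiag fun k => (d k)⁻¹) = 1 := by
  ext i j
  rw [jDiag_matMul, Matrix.neg_apply, jDiag_apply, partner_partner, Matrix.one_apply, partner_div,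
    jSign_partner]
  by_cases h : i = j
  · rw [if_pos h.symm, if_pos h]
    have := jSign_mul_self i
    have := hd (i / 2)
    field_simp
    linear_combination jSign_mul_self i
  · rw [if_neg (Ne.symm h), if_neg h]
    simp

theorem blockInv_jDiag (d : ℕ → ℂ) (hd : ∀ k, d k ≠ 0) :
    blockInv (jDiag d) = -jDiag fun k => (d k)⁻¹ :=
  (blockLower_jDiag d).blockInv_eq (jDiag_mul_inv d hd)

theorem jDiag_conj (d : ℕ → ℂ) (hd : ∀ k, d k ≠ 0) (A : SMat) (i j : ℕ) :
    (jDiag d ⋅ₘ A ⋅ₘ blockInv (jDiag d)) i j =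
      jSign i * jSign j * (d (i / 2) / d (j / 2)) * A (partner i) (partner j) := by
  rw [blockInv_jDiag d hd, matMul_neg, Matrix.neg_apply, matMul_jDiag, jDiag_matMul]
  ring

/-- Conjugation by `diag (r₀, r₀, r₁, r₁, ...)`. -/
noncomputable def diagConj (r : ℕ → ℂ) (A : SMat) : SMat := fun i j =>
  (r (i / 2))⁻¹ * A i j * r (j / 2)

theorem diagConj_matMul (r : ℕ → ℂ) (hr : ∀ k, r k ≠ 0) (A B : SMat) :
    diagConj r (A ⋅ₘ B) = diagConj r A ⋅ₘ diagConj r B := by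
  ext i j
  simp only [diagConj, matMul]
  rw [mul_assoc, mul_comm _ (r (j / 2)), ← smul_eq_mul, ← smul_eq_mul, smul_finsum, smul_finsum]
  refine finsum_congr fun k => ?_
  have := hr (k / 2)
  simp only [smul_eq_mul]
  field_simp

theorem diagConj_one (r : ℕ → ℂ) (hr : ∀ k, r k ≠ 0) : diagConj r 1 = 1 := by
  ext i j
  by_cases h : i = j
  · subst h; simp [diagConj, hr]
  · simp [diagConj, h]

theorem diagConj_matPow (r : ℕ → ℂ) (hr : ∀ k, r k ≠ 0) (A : SMat) (n : ℕ) :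
    diagConj r (matPow A n) = matPow (diagConj r A) n := by
  induction n with
  | zero => exact diagConj_one r hr
  | succ n ih => rw [matPow, diagConj_matMul r hr, ih]; rfl

theorem RowFinite.diagConj {A : SMat} (hA : RowFinite A) (r : ℕ → ℂ) :
    RowFinite (diagConj r A) := by
  intro i
  obtain ⟨N, hN⟩ := hA i
  exact ⟨N, fun k hk => by simp [PfaffToda.diagConj, hN k hk]⟩

/-! ### The moments: skew symmetry and dependence on the times -/

theorem weight_skew {F : ℝ → ℝ → ℂ} (hF : ∀ x y, F y x = -F x y) (t : Times) (x y : ℝ) :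
    weight F t (-t) y x = -weight F t (-t) x y := by
  unfold weight
  rw [hF x y, mul_neg]
  congr 3
  refine tsum_congr fun i => ?_
  simp only [Pi.neg_apply]
  ring

theorem moment_skew {F : ℝ → ℝ → ℂ} (hF : ∀ x y, F y x = -F x y) (t : Times) (k l : ℕ) :
    moment F t (-t) k l = -moment F t (-t) l k := by
  unfold moment innerProd
  rw [← integral_neg, Measure.volume_eq_prod, ← integral_prod_swap]
  refine integral_congr_ae (Eventually.of_forall fun p => ?_)
  simp only [Prod.fst_swap, Prod.snd_swap]
  rw [weight_skew hF]
  ring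

/-- Summability is what allows the exponent series to be split, since divergent sums have the
default value `0`. It is needed only where `F ≠ 0`, both sides vanishing elsewhere. -/
theorem weight_add_single (F : ℝ → ℝ → ℂ) (s : Times) (m : ℕ+) (a : ℂ) (x y : ℝ)
    (h : F x y ≠ 0 → Summable fun i : ℕ+ => s i * (x : ℂ) ^ (i : ℕ) - (-s) i * (y : ℂ) ^ (i : ℕ)) :
    weight F (s + Pi.single m a) (-(s + Pi.single m a)) x y =
      Complex.exp (a * ((x : ℂ) ^ (m : ℕ) + (y : ℂ) ^ (m : ℕ))) * weight F s (-s) x y := by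
  unfold weight
  by_cases hF : F x y = 0
  · simp [hF]
  · have h1 : HasSum (fun i : ℕ+ => (Pi.single m a : Times) i * ((x : ℂ) ^ (i : ℕ) + (y : ℂ) ^ (i : ℕ)))
        (a * ((x : ℂ) ^ (m : ℕ) + (y : ℂ) ^ (m : ℕ))) := by
      have := hasSum_single (f := fun i : ℕ+ =>
        (Pi.single m a : Times) i * ((x : ℂ) ^ (i : ℕ) + (y : ℂ) ^ (i : ℕ))) m
        (fun i hi => by simp [Pi.single_eq_of_ne hi])
      simpa using this
    rw [← mul_assoc, ← Complex.exp_add, ← h1.tsum_eq,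
      add_comm (∑' i : ℕ+, _ * _), ← ((h hF).tsum_add h1.summable)]
    congr 2
    refine tsum_congr fun i => ?_
    simp only [Pi.neg_apply, Pi.add_apply]
    ring

/-- A bound uniform in complex `a` by the two real endpoints `±ε`; both are needed because `u` may
have either sign. -/
theorem norm_exp_mul_le (a : ℂ) (ε u : ℝ) (ha : ‖a‖ ≤ ε) :
    ‖Complex.exp (a * u)‖ ≤ ‖Complex.exp ((ε : ℂ) * u)‖ + ‖Complex.exp (((-ε : ℝ) : ℂ) * u)‖ := by
  have h1 := (abs_le.mp ((Complex.abs_re_le_norm a).trans ha))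
  simp only [Complex.norm_exp, ← Complex.ofReal_mul, Complex.ofReal_re, Complex.re_mul_ofReal]
  rcases le_total 0 u with hu | hu
  · have : Real.exp (a.re * u) ≤ Real.exp (ε * u) :=
      Real.exp_le_exp.mpr (mul_le_mul_of_nonneg_right h1.2 hu)
    linarith [Real.exp_pos (-ε * u)]
  · have : Real.exp (a.re * u) ≤ Real.exp (-ε * u) :=
      Real.exp_le_exp.mpr (mul_le_mul_of_nonpos_right h1.1 hu)
    linarith [Real.exp_pos (ε * u)]

/-- `∂ μ_{kl} / ∂ t_m = μ_{k+m, l} + μ_{k, l+m}` along `(t, -t)`. -/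
theorem hasDerivAt_moment (F : ℝ → ℝ → ℂ) (s : Times) (m : ℕ+)
    (h : ∀ᶠ a in 𝓝 (0 : ℂ), Converges F (s + Pi.single m a) (-(s + Pi.single m a))) (k l : ℕ) :
    HasDerivAt (fun a : ℂ => moment F (s + Pi.single m a) (-(s + Pi.single m a)) k l)
      (moment F s (-s) (k + m) l + moment F s (-s) k (l + m)) 0 := by
  obtain ⟨δ, hδ, hball⟩ := Metric.eventually_nhds_iff.mp h
  have h0 : Converges F s (-s) := by simpa using h.self_of_nhds
  let G : ℕ → ℕ → ℝ × ℝ → ℂ := fun k l p =>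
    (p.1 : ℂ) ^ k * (p.2 : ℂ) ^ l * weight F s (-s) p.1 p.2
  let u : ℝ × ℝ → ℝ := fun p => p.1 ^ (m : ℕ) + p.2 ^ (m : ℕ)
  have hae : ∀ a k l, (fun p : ℝ × ℝ => (p.1 : ℂ) ^ k * (p.2 : ℂ) ^ l *
      weight F (s + Pi.single m a) (-(s + Pi.single m a)) p.1 p.2) =ᵐ[volume]
      fun p => Complex.exp (a * u p) * G k l p := by
    intro a k l
    filter_upwards [h0.1] with p hp
    rw [weight_add_single F s m a p.1 p.2 hp]
    simp only [u, G]
    push_cast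
    ring
  have hmom : ∀ a k l, moment F (s + Pi.single m a) (-(s + Pi.single m a)) k l =
      ∫ p, Complex.exp (a * u p) * G k l p := fun a k l => integral_congr_ae (hae a k l)
  have hint : ∀ a : ℂ, ‖a‖ < δ → ∀ k l, Integrable fun p => Complex.exp (a * u p) * G k l p :=
    fun a ha k l => ((hball (y := a) (by simpa using ha)).2 k l).congr (hae a k l)
  have hint0 : ∀ k l, Integrable (G k l) := h0.2
  let D : ℝ × ℝ → ℂ := fun p => G (k + m) l p + G k (l + m) p
  have hD : ∀ p, (u p : ℂ) * G k l p = D p := by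
    intro p
    simp only [u, G, D]
    push_cast
    ring
  have hDint : ∀ a : ℂ, ‖a‖ < δ → Integrable fun p => Complex.exp (a * u p) * D p := by
    intro a ha
    simp only [D, mul_add]
    exact (hint a ha (k + m) l).add (hint a ha k (l + m))
  have hε1 : ‖((δ / 2 : ℝ) : ℂ)‖ < δ := by
    rw [Complex.norm_real, Real.norm_of_nonneg (by linarith)]; linarith
  have hε2 : ‖((-(δ / 2) : ℝ) : ℂ)‖ < δ := by
    rw [Complex.norm_real, norm_neg, Real.norm_of_nonneg (by linarith)]; linarith
  -- The ball is shrunk to radius `δ / 2` so that the dominating function uses the weight at the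
  -- times shifted by `±δ / 2`, where absolute convergence is still assumed.
  have key := (hasDerivAt_integral_of_dominated_loc_of_deriv_le (μ := volume) (𝕜 := ℂ)
    (F := fun a p => Complex.exp (a * u p) * G k l p) (x₀ := 0) (s := Metric.ball 0 (δ / 2))
    (F' := fun a p => Complex.exp (a * u p) * D p)
    (bound := fun p => ‖Complex.exp (((δ / 2 : ℝ) : ℂ) * u p) * D p‖ +
      ‖Complex.exp (((-(δ / 2) : ℝ) : ℂ) * u p) * D p‖)
    (Metric.ball_mem_nhds _ (by linarith))
    (Metric.eventually_nhds_iff.mpr ⟨δ, hδ, fun {a} ha =>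
      (hint a (by simpa using ha) k l).aestronglyMeasurable⟩)
    (hint 0 (by simpa using hδ) k l)
    (hDint 0 (by simpa using hδ)).aestronglyMeasurable
    (Eventually.of_forall fun p a ha => by
      rw [norm_mul, norm_mul, norm_mul, ← add_mul]
      exact mul_le_mul_of_nonneg_right
        (norm_exp_mul_le a _ _ (by simpa using (Metric.mem_ball.mp ha).le)) (norm_nonneg _))
    ((hDint _ hε1).norm.add (hDint _ hε2).norm)
    (Eventually.of_forall fun p a _ => by
      have := (((hasDerivAt_id a).mul_const (u p : ℂ)).cexp).mul_const (G k l p)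
      simp only [id, one_mul] at this
      rw [mul_assoc, hD] at this
      exact this)).2
  have hval : ∫ p, Complex.exp (0 * u p) * D p =
      moment F s (-s) (k + m) l + moment F s (-s) k (l + m) := by
    simp only [zero_mul, Complex.exp_zero, one_mul, D]
    exact integral_add (hint0 _ _) (hint0 _ _)
  rw [← hval]
  simpa only [hmom] using key

/-! ### Monic skew-orthogonal polynomials of a moment matrix -/

/-- Coefficients of the monic skew-orthogonal polynomials attached to the matrix `M`: row `i` is
`z ^ i` plus a combination of the `z ^ j`, `j < 2 (i / 2)`, orthogonal to these `z ^ j`. -/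
noncomputable def skewCoeff (M : SMat) : SMat := fun i j =>
  if h : j < 2 * (i / 2) then
    -∑ l : Fin (2 * (i / 2)), M i l * (trunc (2 * (i / 2)) M)⁻¹ l ⟨j, h⟩
  else (1 : SMat) i j

theorem skewCoeff_of_le (M : SMat) {i j : ℕ} (h : 2 * (i / 2) ≤ j) :
    skewCoeff M i j = (1 : SMat) i j := dif_neg (by omega)

theorem blockLower_skewCoeff (M : SMat) : BlockLower (skewCoeff M) := fun i j h => by
  rw [skewCoeff_of_le M (by omega), Matrix.one_apply_ne (by omega)]

/-- A row of the right shape is orthogonal to lower degrees iff it is the row of `skewCoeff`. -/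
theorem eq_skewCoeff_iff (M : SMat) (i : ℕ) (hM : (trunc (2 * (i / 2)) M).det ≠ 0) (c : ℕ → ℂ)
    (hc : ∀ j, 2 * (i / 2) ≤ j → c j = (1 : SMat) i j) :
    (∀ l < 2 * (i / 2), ∑ j ∈ Finset.range (2 * (i / 2) + 2), c j * M j l = 0) ↔
      ∀ j, c j = skewCoeff M i j := by
  have hunit : IsUnit (trunc (2 * (i / 2)) M).det := hM.isUnit
  have hsum : ∀ l, ∑ j ∈ Finset.range (2 * (i / 2) + 2), c j * M j l =
      ∑ j : Fin (2 * (i / 2)), c j * M j l + M i l := by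
    intro l
    rw [Finset.sum_range_succ, Finset.sum_range_succ, Fin.sum_univ_eq_sum_range
      (fun j => c j * M j l), add_assoc, hc _ le_rfl, hc _ (Nat.le_succ _)]
    congr 1
    rcases Nat.mod_two_eq_zero_or_one i with h | h
    · have : 2 * (i / 2) = i := by omega
      rw [this]; simp
    · have : 2 * (i / 2) + 1 = i := by omega
      rw [Matrix.one_apply_ne (by omega), Nat.succ_eq_add_one, this]; simp
  have hvec : (∀ l < 2 * (i / 2), ∑ j ∈ Finset.range (2 * (i / 2) + 2), c j * M j l = 0) ↔
      Matrix.vecMul (fun j : Fin (2 * (i / 2)) => c j) (trunc (2 * (i / 2)) M) =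
        -fun l : Fin (2 * (i / 2)) => M i l := by
    simp_rw [hsum]
    constructor
    · intro h
      funext l
      exact eq_neg_of_add_eq_zero_left (h l l.2)
    · intro h l hl
      have := congrFun h ⟨l, hl⟩
      simp only [Matrix.vecMul, dotProduct, trunc_apply, Pi.neg_apply] at this
      rw [this, neg_add_cancel]
  rw [hvec]
  constructor
  · intro h j
    by_cases hj : j < 2 * (i / 2)
    · have h2 := congrArg (fun v => Matrix.vecMul v (trunc (2 * (i / 2)) M)⁻¹) h
      simp only [Matrix.vecMul_vecMul, Matrix.mul_nonsing_inv _ hunit, Matrix.vecMul_one] at h2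
      have h3 := congrFun h2 ⟨j, hj⟩
      simp only [Matrix.neg_vecMul] at h3
      rw [h3, skewCoeff, dif_pos hj]
      rfl
    · rw [hc j (by omega), skewCoeff_of_le M (by omega)]
  · intro h
    have h2 : (fun j : Fin (2 * (i / 2)) => c j) =
        -Matrix.vecMul (fun l : Fin (2 * (i / 2)) => M i l) (trunc (2 * (i / 2)) M)⁻¹ := by
      funext j
      rw [h, skewCoeff, dif_pos j.2]
      rfl
    rw [h2, Matrix.neg_vecMul, Matrix.vecMul_vecMul, Matrix.nonsing_inv_mul _ hunit,
      Matrix.vecMul_one]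

theorem skewCoeff_orthogonal (M : SMat) {i l : ℕ} (hM : (trunc (2 * (i / 2)) M).det ≠ 0)
    (hl : l < 2 * (i / 2)) :
    ∑ j ∈ Finset.range (2 * (i / 2) + 2), skewCoeff M i j * M j l = 0 :=
  (eq_skewCoeff_iff M i hM _ fun _ h => skewCoeff_of_le M h).mpr (fun _ => rfl) l hl

/-- The polynomial in row `2n` is also orthogonal to `z ^ (2n)`. -/
theorem skewCoeff_even_orthogonal (M : SMat) (hskew : ∀ k l, M k l = -M l k) (n : ℕ)
    (hM : (trunc (2 * n) M).det ≠ 0) {l : ℕ} (hl : l ≤ 2 * n) :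
    ∑ j ∈ Finset.range (2 * n + 1), skewCoeff M (2 * n) j * M j l = 0 := by
  have hdiv : 2 * n / 2 = n := by omega
  have hlt : ∀ l < 2 * n, ∑ j ∈ Finset.range (2 * n + 1), skewCoeff M (2 * n) j * M j l = 0 := by
    intro l hl
    have := skewCoeff_orthogonal M (i := 2 * n) (l := l) (by rwa [hdiv]) (by rwa [hdiv])
    rw [hdiv, Finset.sum_range_succ, skewCoeff_of_le M (by omega),
      Matrix.one_apply_ne (by omega), zero_mul, add_zero] at this
    exact this
  rcases hl.lt_or_eq with h | rfl
  · exact hlt l h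
  · set c := skewCoeff M (2 * n)
    have hc : c (2 * n) = 1 := by
      simp only [c]; rw [skewCoeff_of_le M (by omega), Matrix.one_apply_eq]
    -- The pairing with `z ^ (2n)` equals the quadratic form `c M cᵀ`, because `c` is monic and the
    -- pairings with lower powers vanish. A quadratic form of a skew matrix is its own negative.
    have h1 : ∑ l ∈ Finset.range (2 * n + 1), (∑ j ∈ Finset.range (2 * n + 1), c j * M j l) * c l =
        ∑ j ∈ Finset.range (2 * n + 1), c j * M j (2 * n) := by
      rw [Finset.sum_range_succ, hc, mul_one, Finset.sum_eq_zero, zero_add]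
      intro l hl
      rw [hlt l (Finset.mem_range.mp hl), zero_mul]
    have h2 : ∑ l ∈ Finset.range (2 * n + 1), (∑ j ∈ Finset.range (2 * n + 1), c j * M j l) * c l =
        -∑ l ∈ Finset.range (2 * n + 1), (∑ j ∈ Finset.range (2 * n + 1), c j * M j l) * c l := by
      conv_rhs => rw [← Finset.sum_neg_distrib]
      simp_rw [Finset.sum_mul, ← Finset.sum_neg_distrib]
      rw [Finset.sum_comm]
      refine Finset.sum_congr rfl fun l _ => Finset.sum_congr rfl fun j _ => ?_
      rw [hskew l j]
      ring
    rw [← h1]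
    exact self_eq_neg.mp h2

/-! ### The shifted tau function -/

/-- The companion matrix of `z ^ N + ∑ j < N, c j z ^ j`. -/
def companion (N : ℕ) (c : ℕ → ℂ) : Matrix (Fin N) (Fin N) ℂ := Matrix.of fun i j =>
  if (i : ℕ) + 1 < N then if (j : ℕ) = i + 1 then 1 else 0 else -c j

theorem companion_sum (N : ℕ) (c : ℕ → ℂ) {R : Type*} [CommRing R] (f : ℂ →+* R) (g : ℕ → R)
    (i : Fin N) : ∑ j, f (companion N c i j) * g j =
      if (i : ℕ) + 1 < N then g (i + 1) else -∑ j ∈ Finset.range N, f (c j) * g j := by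
  unfold companion
  split_ifs with h
  · rw [Finset.sum_eq_single ⟨i + 1, h⟩]
    · simp [h]
    · intro j _ hj
      have : (j : ℕ) ≠ i + 1 := fun hh => hj (Fin.ext hh)
      simp [h, this]
    · simp
  · simp only [Matrix.of_apply, if_neg h, map_neg, neg_mul]
    rw [Finset.sum_neg_distrib, Fin.sum_univ_eq_sum_range (fun j => f (c j) * g j)]

/-- The characteristic matrix sends `(1, z, ..., z ^ (N - 1))` to `q` times the last basis vector.
Applying the adjugate and reading the first coordinate shows that `q` divides the characteristic
polynomial; both are monic of degree `N`. -/
theorem charpoly_companion (N : ℕ) (c : ℕ → ℂ) :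
    (companion N c).charpoly = X ^ N + ∑ j ∈ Finset.range N, C (c j) * X ^ j := by
  set q : ℂ[X] := X ^ N + ∑ j ∈ Finset.range N, C (c j) * X ^ j with hq
  have hdeg : (∑ j ∈ Finset.range N, C (c j) * (X : ℂ[X]) ^ j).degree < (N : WithBot ℕ) := by
    rw [degree_lt_iff_coeff_zero]
    intro m hm
    rw [finsetSum_coeff]
    refine Finset.sum_eq_zero fun j hj => ?_
    rw [coeff_C_mul_X_pow, if_neg (by have := Finset.mem_range.mp hj; omega)]
  have hqm : q.Monic := monic_X_pow_add hdeg
  have hqd : q.natDegree = N := by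
    rw [hq, natDegree_add_eq_left_of_degree_lt (by rwa [degree_X_pow]), natDegree_X_pow]
  rcases Nat.eq_zero_or_pos N with rfl | hN
  · simp [hq, Matrix.charpoly]
  have hmul : (companion N c).charmatrix.mulVec (fun i => X ^ (i : ℕ)) =
      fun i : Fin N => if (i : ℕ) + 1 < N then 0 else q := by
    funext i
    have h1 := companion_sum N c C (fun j => (X : ℂ[X]) ^ j) i
    have h2 : (companion N c).charmatrix.mulVec (fun i => (X : ℂ[X]) ^ (i : ℕ)) i =
        X * X ^ (i : ℕ) - ∑ j, C (companion N c i j) * X ^ (j : ℕ) := by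
      simp only [Matrix.mulVec, dotProduct, Matrix.charmatrix_apply, sub_mul,
        Finset.sum_sub_distrib]
      congr 1
      rw [Finset.sum_eq_single i]
      · simp
      · intro j _ hj
        rw [Matrix.diagonal_apply_ne _ hj.symm, zero_mul]
      · simp
    rw [h2, h1]
    split_ifs with h
    · exact sub_eq_zero.mpr (pow_succ' _ _).symm
    · have : (i : ℕ) + 1 = N := by omega
      rw [hq, ← pow_succ', this]
      exact sub_neg_eq_add _ _
  have hdvd : q ∣ (companion N c).charpoly := by
    have h1 := congrArg (fun v => (companion N c).charmatrix.adjugate.mulVec v) hmul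
    simp only [Matrix.mulVec_mulVec, Matrix.adjugate_mul, Matrix.smul_mulVec,
      Matrix.one_mulVec] at h1
    have h2 := congrFun h1 ⟨0, hN⟩
    simp only [Pi.smul_apply, pow_zero, smul_eq_mul, mul_one] at h2
    rw [Matrix.charpoly, h2, Matrix.mulVec, dotProduct]
    refine Finset.dvd_sum fun i _ => ?_
    exact Dvd.dvd.mul_left (by split_ifs <;> simp) _
  refine eq_of_monic_of_dvd_of_natDegree_le hqm (Matrix.charpoly_monic _) hdvd ?_
  rw [Matrix.charpoly_natDegree_eq_dim, Fintype.card_fin, hqd]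

theorem pf_map {R S : Type*} [CommRing R] [Algebra ℚ R] [CommRing S] [Algebra ℚ S] (f : R →+* S)
    (n : ℕ) (A : Matrix (Fin (2 * n)) (Fin (2 * n)) R) : pf n (A.map f) = f (pf n A) := by
  unfold pf
  rw [Algebra.smul_def, Algebra.smul_def, map_mul, map_sum, RingHom.map_rat_algebraMap]
  simp

/-- The polynomial whose value at `w` is the moment matrix for the weight multiplied by
`(1 - w x) (1 - w y)`. -/
noncomputable def shiftedMoments (M : SMat) (N : ℕ) : Matrix (Fin N) (Fin N) ℂ[X] :=
  Matrix.of fun i j => C (M i j) - C (M (i + 1) j + M i (j + 1)) * X + C (M (i + 1) (j + 1)) * X ^ 2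

/-- The companion matrix is multiplication by `z` modulo the polynomial of row `2n`. That polynomial
is orthogonal to every degree involved, so reducing modulo it does not change the pairings, and `1 -
w K` acts as the factor `1 - w x`. -/
theorem shiftedMoments_eq (M : SMat) (hskew : ∀ k l, M k l = -M l k) (n : ℕ)
    (hM : (trunc (2 * n) M).det ≠ 0) :
    shiftedMoments M (2 * n) =
      (1 - (X : ℂ[X]) • (companion (2 * n) (skewCoeff M (2 * n))).map C) * (trunc (2 * n) M).map C *
        (1 - (X : ℂ[X]) • (companion (2 * n) (skewCoeff M (2 * n))).map C).transpose := by
  set K := companion (2 * n) (skewCoeff M (2 * n)) with hK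
  have hrow : ∀ (i : Fin (2 * n)) (l : ℕ), l ≤ 2 * n → ∑ j : Fin (2 * n), K i j * M j l =
      M (i + 1) l := by
    intro i l hl
    have := companion_sum (2 * n) (skewCoeff M (2 * n)) (RingHom.id ℂ) (fun j => M j l) i
    simp only [RingHom.id_apply] at this
    rw [hK, this]
    split_ifs with h
    · rfl
    · have h2 := skewCoeff_even_orthogonal M hskew n hM hl
      have h3 : (i : ℕ) + 1 = 2 * n := by omega
      rw [Finset.sum_range_succ, skewCoeff_of_le M (by omega), Matrix.one_apply_eq, one_mul] at h2
      rw [h3]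
      linear_combination -h2
  have h1 : K * trunc (2 * n) M = Matrix.of fun i j : Fin (2 * n) => M (i + 1) j := by
    ext i j
    rw [Matrix.mul_apply]
    exact hrow i j (by omega)
  have h2 : trunc (2 * n) M * K.transpose = Matrix.of fun i j : Fin (2 * n) => M i (j + 1) := by
    ext i j
    rw [Matrix.mul_apply, Matrix.of_apply, hskew, ← hrow j i (by omega), ← Finset.sum_neg_distrib]
    refine Finset.sum_congr rfl fun l _ => ?_
    rw [trunc_apply, hskew, Matrix.transpose_apply]
    ring
  -- The last column needs `hrow` at `l = 2 * n`, hence the extra orthogonality of the even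
  -- polynomial to `z ^ (2n)`.
  have h3 : K * trunc (2 * n) M * K.transpose =
      Matrix.of fun i j : Fin (2 * n) => M (i + 1) (j + 1) := by
    rw [Matrix.mul_assoc, h2]
    ext i j
    rw [Matrix.mul_apply]
    exact hrow i (j + 1) (by omega)
  have h4 : (1 - (X : ℂ[X]) • K.map C) * (trunc (2 * n) M).map C *
      (1 - (X : ℂ[X]) • K.map C).transpose =
      (trunc (2 * n) M).map C - (X : ℂ[X]) • ((K * trunc (2 * n) M).map C +
        (trunc (2 * n) M * K.transpose).map C) +
        (X : ℂ[X]) ^ 2 • (K * trunc (2 * n) M * K.transpose).map C := by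
    simp only [Matrix.map_mul, Matrix.transpose_sub, Matrix.transpose_one, Matrix.transpose_smul,
      Matrix.transpose_map, sub_mul, mul_sub, one_mul, mul_one, Matrix.smul_mul, Matrix.mul_smul,
      smul_add, smul_smul, pow_two]
    abel
  rw [h4, h3, h2, h1]
  refine Matrix.ext fun i j => ?_
  simp only [shiftedMoments, Matrix.of_apply, Matrix.add_apply, Matrix.sub_apply, Matrix.map_apply,
    Matrix.smul_apply, smul_eq_mul, trunc_apply, map_add]
  ring

/-- The moment matrix at `(t, -t)`. -/
noncomputable def momentMat (F : ℝ → ℝ → ℂ) (t : Times) : SMat := fun i j => moment F t (-t) i j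

theorem momentMat_skew {F : ℝ → ℝ → ℂ} (hF : ∀ x y, F y x = -F x y) (t : Times) (k l : ℕ) :
    momentMat F t k l = -momentMat F t l k := moment_skew hF t k l

theorem tau_eq (F : ℝ → ℝ → ℂ) (n : ℕ) (t : Times) :
    tau F n t = pf n (trunc (2 * n) (momentMat F t)) := rfl

theorem tauShift_eq (F : ℝ → ℝ → ℂ) (n : ℕ) (t : Times) :
    tauShift F n t = pf n (shiftedMoments (momentMat F t) (2 * n)) := rfl

theorem trunc_transpose {M : SMat} (hskew : ∀ k l, M k l = -M l k) (N : ℕ) :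
    (trunc N M).transpose = -trunc N M := by
  ext i j
  exact hskew _ _

theorem det_momentMat_ne_zero {F : ℝ → ℝ → ℂ} (hF : ∀ x y, F y x = -F x y) {n : ℕ} {t : Times}
    (hτ : tau F n t ≠ 0) : (trunc (2 * n) (momentMat F t)).det ≠ 0 :=
  det_ne_zero_of_pf_ne_zero n _ (trunc_transpose (momentMat_skew hF t) _) hτ

/-- By congruence the shifted tau function is `τ` times the reversed characteristic polynomial of
the companion matrix of row `2n`; reflecting in degree `2n` returns that row. -/
theorem numer_coeff {F : ℝ → ℝ → ℂ} (hF : ∀ x y, F y x = -F x y) {n : ℕ} {t : Times}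
    (hτ : tau F n t ≠ 0) (j : ℕ) :
    (numer F n t).coeff j = tau F n t * skewCoeff (momentMat F t) (2 * n) j := by
  set c := skewCoeff (momentMat F t) (2 * n) with hc
  have hpoly : numer F n t = C (tau F n t) * (companion (2 * n) c).charpoly := by
    have h1 : tauShift F n t = C (tau F n t) * (companion (2 * n) c).charpolyRev := by
      rw [tauShift_eq, shiftedMoments_eq _ (momentMat_skew hF t) n (det_momentMat_ne_zero hF hτ),
        pf_congruence, pf_map, mul_comm]
      rfl
    have h2 : (companion (2 * n) c).charpoly.natDegree = 2 * n := by
      rw [Matrix.charpoly_natDegree_eq_dim, Fintype.card_fin]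
    rw [numer, h1, reflect_C_mul, ← Matrix.reverse_charpoly, Polynomial.reverse, h2]
    simp
  rw [hpoly, coeff_C_mul, charpoly_companion]
  congr 1
  rw [coeff_add, coeff_X_pow, finsetSum_coeff]
  simp_rw [coeff_C_mul_X_pow]
  by_cases hj : j < 2 * n
  · rw [if_neg (by omega), zero_add, Finset.sum_eq_single j]
    · simp
    · intro b _ hb; rw [if_neg (Ne.symm hb)]
    · intro h; exact absurd (Finset.mem_range.mpr hj) h
  · rw [Finset.sum_eq_zero, add_zero, hc, skewCoeff_of_le _ (by omega), Matrix.one_apply]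
    · simp [eq_comm]
    · intro b hb
      rw [if_neg]
      have := Finset.mem_range.mp hb
      omega

/-! ### Differentiating determinants, inverses and Pfaffians -/

theorem differentiableAt_det {N : ℕ} {A : ℂ → Matrix (Fin N) (Fin N) ℂ} {x : ℂ}
    (hA : ∀ i j, DifferentiableAt ℂ (fun a => A a i j) x) :
    DifferentiableAt ℂ (fun a => (A a).det) x := by
  simp only [Matrix.det_apply']
  fun_prop

theorem differentiableAt_inv_apply {N : ℕ} {A : ℂ → Matrix (Fin N) (Fin N) ℂ} {x : ℂ}
    (hA : ∀ i j, DifferentiableAt ℂ (fun a => A a i j) x) (h : (A x).det ≠ 0) (i j : Fin N) :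
    DifferentiableAt ℂ (fun a => (A a)⁻¹ i j) x := by
  have hadj : DifferentiableAt ℂ (fun a => (A a).adjugate i j) x := by
    simp only [Matrix.adjugate_apply]
    refine differentiableAt_det fun k l => ?_
    simp only [Matrix.updateRow_apply]
    split_ifs
    · exact differentiableAt_const _
    · exact hA k l
  have : (fun a => (A a)⁻¹ i j) = fun a => (A a).det⁻¹ * (A a).adjugate i j := by
    funext a
    rw [Matrix.inv_def, Ring.inverse_eq_inv', Matrix.smul_apply, smul_eq_mul]
  rw [this]
  exact ((differentiableAt_det hA).inv h).mul hadj

/-- Once differentiability is known from the adjugate formula, the value follows by differentiating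
`A A⁻¹ = 1`, which holds near `x`. -/
theorem hasDerivAt_inv_apply {N : ℕ} {A : ℂ → Matrix (Fin N) (Fin N) ℂ}
    {A' : Matrix (Fin N) (Fin N) ℂ} {x : ℂ}
    (hA : ∀ i j, HasDerivAt (fun a => A a i j) (A' i j) x) (h : (A x).det ≠ 0) (i j : Fin N) :
    HasDerivAt (fun a => (A a)⁻¹ i j) ((-((A x)⁻¹ * A' * (A x)⁻¹)) i j) x := by
  have hd := differentiableAt_inv_apply (fun i j => (hA i j).differentiableAt) h
  set D : Matrix (Fin N) (Fin N) ℂ := Matrix.of fun i j => deriv (fun a => (A a)⁻¹ i j) x with hD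
  have hprod : A' * (A x)⁻¹ + A x * D = 0 := by
    ext k l
    have h1 : HasDerivAt (fun a => ∑ m, A a k m * (A a)⁻¹ m l)
        (∑ m, (A' k m * (A x)⁻¹ m l + A x k m * D m l)) x :=
      HasDerivAt.fun_sum fun m _ => (hA k m).mul (hd m l).hasDerivAt
    have h2 : (fun a => ∑ m, A a k m * (A a)⁻¹ m l) =ᶠ[𝓝 x]
        fun _ => (1 : Matrix (Fin N) (Fin N) ℂ) k l := by
      have hcont := (differentiableAt_det fun i j => (hA i j).differentiableAt).continuousAt
      filter_upwards [hcont.eventually_ne h] with a ha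
      rw [← Matrix.mul_apply, Matrix.mul_nonsing_inv _ ha.isUnit]
    have h3 := h1.unique ((hasDerivAt_const x _).congr_of_eventuallyEq h2)
    rw [Matrix.add_apply, Matrix.mul_apply, Matrix.mul_apply, ← Finset.sum_add_distrib, h3,
      Matrix.zero_apply]
  have hDval : D = -((A x)⁻¹ * A' * (A x)⁻¹) := by
    have h1 := congrArg (fun B => (A x)⁻¹ * B) hprod
    simp only [mul_add, mul_zero, ← Matrix.mul_assoc, Matrix.nonsing_inv_mul _ h.isUnit,
      Matrix.one_mul] at h1
    exact eq_neg_of_add_eq_zero_right h1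
  rw [← hDval]
  exact (hd i j).hasDerivAt

/-- The derivative of the Pfaffian along a curve depends only on the value and the derivative of
the curve. -/
theorem exists_hasDerivAt_pf (n : ℕ) (B B' : Matrix (Fin (2 * n)) (Fin (2 * n)) ℂ) :
    ∃ d : ℂ, (∀ A : ℂ → Matrix (Fin (2 * n)) (Fin (2 * n)) ℂ, A 0 = B →
      (∀ i j, HasDerivAt (fun a => A a i j) (B' i j) 0) →
        HasDerivAt (fun a => pf n (A a)) d 0) ∧
      ∀ A : ℂ → Matrix (Fin (2 * n)) (Fin (2 * n)) ℂ, A 0 = B →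
      (∀ i j, HasDerivAt (fun a => A a i j) (-B' i j) 0) →
        HasDerivAt (fun a => pf n (A a)) (-d) 0 := by
  let f : (Fin (2 * n) → Fin (2 * n) → ℂ) → ℂ := fun A => pf n (Matrix.of A)
  have hf : Differentiable ℂ f := by
    simp only [f, pf, Algebra.smul_def, Matrix.of_apply]
    fun_prop
  have key : ∀ (A : ℂ → Matrix (Fin (2 * n)) (Fin (2 * n)) ℂ) (C' : Fin (2 * n) → Fin (2 * n) → ℂ),
      A 0 = B → (∀ i j, HasDerivAt (fun a => A a i j) (C' i j) 0) →
        HasDerivAt (fun a => pf n (A a)) (fderiv ℂ f B C') 0 := by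
    intro A C' h0 hA
    have h1 : HasDerivAt (fun a => (A a : Fin (2 * n) → Fin (2 * n) → ℂ)) C' 0 :=
      hasDerivAt_pi.mpr fun i => hasDerivAt_pi.mpr fun j => hA i j
    have h2 : HasFDerivAt f (fderiv ℂ f B) (A 0) := by rw [h0]; exact (hf _).hasFDerivAt
    exact h2.comp_hasDerivAt (0 : ℂ) h1
  refine ⟨fderiv ℂ f B B', fun A h0 hA => key A _ h0 hA, fun A h0 hA => ?_⟩
  have h1 := key A (fun i j => -B' i j) h0 hA
  have h2 : fderiv ℂ f B (fun i j => -B' i j) = -fderiv ℂ f B B' := (fderiv ℂ f B).map_neg B'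
  rwa [h2] at h1

theorem differentiableAt_pf (n : ℕ) {A : ℂ → Matrix (Fin (2 * n)) (Fin (2 * n)) ℂ}
    (hA : ∀ i j, DifferentiableAt ℂ (fun a => A a i j) 0) :
    DifferentiableAt ℂ (fun a => pf n (A a)) 0 := by
  obtain ⟨d, hd, -⟩ := exists_hasDerivAt_pf n (A 0) (Matrix.of fun i j => deriv (fun a => A a i j) 0)
  exact (hd A rfl fun i j => (hA i j).hasDerivAt).differentiableAt

theorem differentiableAt_skewCoeff {M : ℂ → SMat}
    (hM : ∀ i j, DifferentiableAt ℂ (fun a => M a i j) 0) (i : ℕ)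
    (h : (trunc (2 * (i / 2)) (M 0)).det ≠ 0) (j : ℕ) :
    DifferentiableAt ℂ (fun a => skewCoeff (M a) i j) 0 := by
  unfold skewCoeff
  split_ifs with hj
  · exact (DifferentiableAt.fun_sum fun (l : Fin (2 * (i / 2))) _ => (hM i l).mul (differentiableAt_inv_apply
      (A := fun a => trunc (2 * (i / 2)) (M a)) (fun k l => hM k l) h l ⟨j, hj⟩)).neg
  · exact differentiableAt_const _

/-! ### Identification of the polynomials `p̃` -/

/-- To first order in `w`, the shift by `-[w]` is `t₁ ↦ t₁ - w`. The two moment curves have opposite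
derivatives at the same point, so their Pfaffians do too. -/
theorem coeff_one_tauShift (F : ℝ → ℝ → ℂ) (n : ℕ) (t : Times) (d : ℂ)
    (hder : ∀ k l, HasDerivAt (fun a : ℂ => momentMat F (t + (Pi.single 1 a : Times)) k l)
      (momentMat F t (k + 1) l + momentMat F t k (l + 1)) 0)
    (hd : HasDerivAt (fun a : ℂ => tau F n (t + (Pi.single 1 a : Times))) d 0) :
    (tauShift F n t).coeff 1 = -d := by
  set M := momentMat F t with hM
  clear_value M
  obtain ⟨e, he, he'⟩ := exists_hasDerivAt_pf n (trunc (2 * n) M)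
    (Matrix.of fun k l => M (k + 1) l + M k (l + 1))
  simp only [tau_eq] at hd
  have hed : e = d := (he (fun a => trunc (2 * n) (momentMat F (t + (Pi.single 1 a : Times))))
    (by simp [hM]) (fun i j => hder i j)).unique hd
  have h1 := he' (fun w => (shiftedMoments M (2 * n)).map (evalRingHom w))
    (by ext i j; simp [shiftedMoments]) (fun i j => by
      have := ((shiftedMoments M (2 * n)) i j).hasDerivAt (0 : ℂ)
      convert! this using 1
      simp [shiftedMoments])
  have h2 : ∀ w : ℂ, pf n ((shiftedMoments M (2 * n)).map (evalRingHom w)) =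
      (tauShift F n t).eval w := fun w => by
    rw [pf_map, hM]; rfl
  simp_rw [h2] at h1
  have h3 := h1.unique ((tauShift F n t).hasDerivAt (0 : ℂ))
  rw [← coeff_zero_eq_eval_zero, coeff_derivative] at h3
  rw [← hed, h3]
  simp

theorem pTilde_even_coeff {F : ℝ → ℝ → ℂ} (hF : ∀ x y, F y x = -F x y) {i : ℕ} {t : Times}
    (hi : i % 2 = 0) (hτ : tau F (i / 2) t ≠ 0) (j : ℕ) :
    (pTilde F i t).coeff j = skewCoeff (momentMat F t) i j := by
  rw [pTilde, if_pos hi, coeff_C_mul, numer_coeff hF hτ, inv_mul_cancel_left₀ hτ,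
    show 2 * (i / 2) = i by omega]

/-- Let `N` be the numerator. Differentiating `⟨N, z ^ l⟩ = 0` in `t₁` gives `⟨(z + ∂) N, z ^ l⟩ +
⟨N, z ^ (l + 1)⟩ = 0`, and the last term vanishes for `l < 2n` because `N` is also orthogonal to `z
^ (2n)`. The remaining condition, that the coefficient of `z ^ (2n)` is zero, is
`coeff_one_tauShift`. -/
theorem pTilde_odd_coeff {F : ℝ → ℝ → ℂ} (hF : ∀ x y, F y x = -F x y) {n : ℕ} {t : Times}
    (hτ : tau F n t ≠ 0)
    (hder : ∀ k l, HasDerivAt (fun a : ℂ => momentMat F (t + (Pi.single 1 a : Times)) k l)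
      (momentMat F t (k + 1) l + momentMat F t k (l + 1)) 0) (j : ℕ) :
    (pTilde F (2 * n + 1) t).coeff j = skewCoeff (momentMat F t) (2 * n + 1) j := by
  set M := momentMat F t with hM
  have hdiv : (2 * n + 1) / 2 = n := by omega
  have hdiv' : 2 * n / 2 = n := by omega
  have hMa : ∀ k l, DifferentiableAt ℂ (fun a : ℂ => momentMat F (t + (Pi.single 1 a : Times)) k l) 0 :=
    fun k l => (hder k l).differentiableAt
  have hM0 : momentMat F (t + (Pi.single 1 0 : Times)) = M := by simp [hM]
  have hdet : (trunc (2 * n) M).det ≠ 0 := det_momentMat_ne_zero hF hτ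
  have hskew : ∀ k l, M k l = -M l k := momentMat_skew hF t
  have hnumer := fun j => numer_coeff hF hτ j
  rw [← hM] at hnumer
  clear_value M
  have hτd : DifferentiableAt ℂ (fun a : ℂ => tau F n (t + (Pi.single 1 a : Times))) 0 :=
    differentiableAt_pf n (A := fun a => trunc (2 * n) (momentMat F (t + (Pi.single 1 a : Times))))
      fun k l => hMa k l
  have hτe : ∀ᶠ a in 𝓝 (0 : ℂ), tau F n (t + (Pi.single 1 a : Times)) ≠ 0 :=
    hτd.continuousAt.eventually_ne (by simpa using hτ)
  let N : ℂ → ℕ → ℂ := fun a j => (numer F n (t + (Pi.single 1 a : Times))).coeff j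
  have hNe : ∀ᶠ a in 𝓝 (0 : ℂ), ∀ j, N a j =
      tau F n (t + (Pi.single 1 a : Times)) * skewCoeff (momentMat F (t + (Pi.single 1 a : Times))) (2 * n) j :=
    hτe.mono fun a ha j => numer_coeff hF ha j
  have hN0 : ∀ j, N 0 j = tau F n t * skewCoeff M (2 * n) j := fun j => by
    simp only [N, Pi.single_zero, add_zero, hnumer]
  have hNlarge : ∀ᶠ a in 𝓝 (0 : ℂ), ∀ j, 2 * n < j → N a j = 0 :=
    hNe.mono fun a ha j hj => by
      rw [ha, skewCoeff_of_le _ (by omega), Matrix.one_apply_ne (by omega), mul_zero]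
  have hNd : ∀ j, DifferentiableAt ℂ (fun a => N a j) 0 := fun j => by
    refine DifferentiableAt.congr_of_eventuallyEq (hτd.mul
      (differentiableAt_skewCoeff hMa (2 * n) (by rw [hM0, hdiv']; exact hdet) j)) ?_
    exact hNe.mono fun a ha => ha j
  set d : ℕ → ℂ := fun j => deriv (fun a => N a j) 0 with hd
  have hdlarge : ∀ j, 2 * n < j → d j = 0 := fun j hj => by
    have : (fun a => N a j) =ᶠ[𝓝 0] fun _ => (0 : ℂ) := hNlarge.mono fun a ha => ha j hj
    rw [hd]
    simp only
    rw [this.deriv_eq, deriv_const]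
  have hnd : ∀ j, (numerDeriv F n t).coeff j = d j := fun j => by
    rw [numerDeriv, finsetSum_coeff]
    simp_rw [coeff_C_mul_X_pow]
    rw [Finset.sum_ite_eq (Finset.range (2 * n + 1)) j d]
    split_ifs with hj
    · rfl
    · exact (hdlarge j (by rw [Finset.mem_range] at hj; omega)).symm
  have hnum : ∀ j, (numer F n t).coeff j = N 0 j := fun j => by simp [N]
  have hcoeff : ∀ j, (pTilde F (2 * n + 1) t).coeff j =
      (tau F n t)⁻¹ * ((if j = 0 then 0 else N 0 (j - 1)) + d j) := fun j => by
    rw [pTilde, if_neg (by omega), hdiv, coeff_C_mul, coeff_add, hnd, ← hnum]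
    congr 2
    cases j with
    | zero => simp
    | succ j => simp [coeff_X_mul]
  have htop : ∀ᶠ a in 𝓝 (0 : ℂ), N a (2 * n) = tau F n (t + (Pi.single 1 a : Times)) :=
    hNe.mono fun a ha => by
      rw [ha, skewCoeff_of_le _ (by omega), Matrix.one_apply_eq, mul_one]
  have hτ' : HasDerivAt (fun a : ℂ => tau F n (t + (Pi.single 1 a : Times))) (d (2 * n)) 0 :=
    (hNd (2 * n)).hasDerivAt.congr_of_eventuallyEq (htop.mono fun a ha => ha.symm)
  have hc1 := coeff_one_tauShift F n t _ (by rwa [hM] at hder) hτ'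
  revert j
  refine (eq_skewCoeff_iff M (2 * n + 1) (by rw [hdiv]; exact hdet) _ ?_).mp ?_
  · intro j hj
    rw [hdiv] at hj
    rw [hcoeff]
    rcases hj.eq_or_lt with rfl | hj
    · rw [Matrix.one_apply_ne (by omega)]
      -- The coefficient of `z ^ (2n - 1)` in the numerator is that of `w` in the shifted tau
      -- function. For `n = 0` the former is absent and the latter is zero.
      have : (if 2 * n = 0 then 0 else N 0 (2 * n - 1)) = (tauShift F n t).coeff 1 := by
        split_ifs with h0
        · obtain rfl : n = 0 := by omega
          have : tauShift F 0 t = 1 := by simp [tauShift, pf]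
          rw [this]
          simp [coeff_one]
        · rw [← hnum, numer, coeff_reflect, revAt_le (by omega)]
          congr 1
          omega
      rw [this, hc1, neg_add_cancel, mul_zero]
    · rw [if_neg (by omega), hdlarge j hj, add_zero, hN0, skewCoeff_of_le _ (by omega),
        inv_mul_cancel_left₀ hτ]
      simp only [Matrix.one_apply]
      congr 1
      apply propext
      omega
  · intro l hl
    rw [hdiv] at hl ⊢
    have hder1 : HasDerivAt (fun a => ∑ j ∈ Finset.range (2 * n + 1),
        N a j * momentMat F (t + (Pi.single 1 a : Times)) j l)
        (∑ j ∈ Finset.range (2 * n + 1), (d j * M j l + N 0 j * (M (j + 1) l + M j (l + 1)))) 0 := by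
      refine HasDerivAt.fun_sum fun j _ => ?_
      have := (hNd j).hasDerivAt.mul (hder j l)
      rwa [hM0] at this
    have hzero : (fun a => ∑ j ∈ Finset.range (2 * n + 1),
        N a j * momentMat F (t + (Pi.single 1 a : Times)) j l) =ᶠ[𝓝 0] fun _ => (0 : ℂ) := by
      filter_upwards [hNe, hτe] with a ha hτa
      simp_rw [ha, mul_assoc]
      rw [← Finset.mul_sum, skewCoeff_even_orthogonal _ (momentMat_skew hF _) n
        (det_momentMat_ne_zero hF hτa) hl.le, mul_zero]
    have h1 := hder1.unique ((hasDerivAt_const (0 : ℂ) (0 : ℂ)).congr_of_eventuallyEq hzero)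
    have h2 : ∑ j ∈ Finset.range (2 * n + 1), N 0 j * M j (l + 1) = 0 := by
      simp_rw [hN0, mul_assoc]
      rw [← Finset.mul_sum, skewCoeff_even_orthogonal _ hskew n hdet hl, mul_zero]
    have h3 : ∑ j ∈ Finset.range (2 * n + 2), (if j = 0 then 0 else N 0 (j - 1)) * M j l =
        ∑ j ∈ Finset.range (2 * n + 1), N 0 j * M (j + 1) l := by
      rw [Finset.sum_range_succ']
      simp
    have h4 : ∑ j ∈ Finset.range (2 * n + 2), d j * M j l =
        ∑ j ∈ Finset.range (2 * n + 1), d j * M j l := by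
      rw [Finset.sum_range_succ, hdlarge _ (by omega), zero_mul, add_zero]
    simp_rw [hcoeff, mul_assoc]
    rw [← Finset.mul_sum]
    simp_rw [add_mul]
    rw [Finset.sum_add_distrib, h3, h4]
    simp_rw [mul_add] at h1
    rw [Finset.sum_add_distrib, Finset.sum_add_distrib, h2] at h1
    rw [show ∑ j ∈ Finset.range (2 * n + 1), N 0 j * M (j + 1) l +
      ∑ j ∈ Finset.range (2 * n + 1), d j * M j l = 0 by linear_combination h1, mul_zero]

/-- The rows of `P̃` are the monic skew-orthogonal polynomials. -/
theorem PTilde_eq_skewCoeff {F : ℝ → ℝ → ℂ} (hF : ∀ x y, F y x = -F x y) {i : ℕ} {t : Times}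
    (hτ : tau F (i / 2) t ≠ 0)
    (hder : ∀ k l, HasDerivAt (fun a : ℂ => momentMat F (t + (Pi.single 1 a : Times)) k l)
      (momentMat F t (k + 1) l + momentMat F t k (l + 1)) 0) (j : ℕ) :
    PTilde F t i j = skewCoeff (momentMat F t) i j := by
  rcases Nat.mod_two_eq_zero_or_one i with hi | hi
  · exact pTilde_even_coeff hF hi hτ j
  · obtain ⟨n, rfl⟩ : ∃ n, i = 2 * n + 1 := ⟨i / 2, by omega⟩
    rw [show (2 * n + 1) / 2 = n by omega] at hτ
    exact pTilde_odd_coeff hF hτ hder j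

/-! ### The skew Borel decomposition -/

theorem BlockLower.gram_apply {U V : SMat} (hU : BlockLower U) (hV : BlockLower V) (Y : SMat)
    {i j N : ℕ} (hi : 2 * (i / 2) + 2 ≤ N) (hj : 2 * (j / 2) + 2 ≤ N) :
    (U ⋅ₘ Y ⋅ₘ V.transpose) i j =
      ∑ l ∈ Finset.range N, ∑ k ∈ Finset.range N, U i k * Y k l * V j l := by
  rw [← Matrix.transpose_apply (U ⋅ₘ Y ⋅ₘ V.transpose), matMul_transpose, Matrix.transpose_transpose,
    matMul_eq_sum (N := N) (fun k hk => hV _ _ (by omega))]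
  refine Finset.sum_congr rfl fun l _ => ?_
  rw [Matrix.transpose_apply, matMul_eq_sum (N := N) (fun k hk => hU _ _ (by omega)),
    Finset.mul_sum]
  exact Finset.sum_congr rfl fun k _ => mul_comm _ _

theorem BlockLower.gram_skew {U V : SMat} (hU : BlockLower U) (hV : BlockLower V) {Y Z : SMat}
    (h : ∀ k l, Y k l = -Z l k) (i j : ℕ) :
    (U ⋅ₘ Y ⋅ₘ V.transpose) i j = -(V ⋅ₘ Z ⋅ₘ U.transpose) j i := by
  rw [hU.gram_apply hV Y (N := i + j + 2) (by omega) (by omega),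
    hV.gram_apply hU Z (N := i + j + 2) (by omega) (by omega), Finset.sum_comm,
    ← Finset.sum_neg_distrib]
  refine Finset.sum_congr rfl fun k _ => ?_
  rw [← Finset.sum_neg_distrib]
  refine Finset.sum_congr rfl fun l _ => ?_
  rw [h k l]
  ring

theorem skewCoeff_matMul_eq_zero (M : SMat) {i l : ℕ} (hM : (trunc (2 * (i / 2)) M).det ≠ 0)
    (hl : l < 2 * (i / 2)) : (skewCoeff M ⋅ₘ M) i l = 0 := by
  rw [matMul_eq_sum (N := 2 * (i / 2) + 2) (fun k hk => blockLower_skewCoeff M _ _ (by omega))]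
  exact skewCoeff_orthogonal M hM hl

theorem det_trunc_skewCoeff (M : SMat) (N : ℕ) : (trunc N (skewCoeff M)).det = 1 := by
  rw [Matrix.det_of_isLowerTriangular]
  · refine Finset.prod_eq_one fun i _ => ?_
    rw [trunc_apply, skewCoeff_of_le M (by omega), Matrix.one_apply_eq]
  · intro i j hij
    have : (i : ℕ) < j := hij
    rw [trunc_apply, skewCoeff_of_le M (by omega), Matrix.one_apply_ne (by omega)]

theorem BlockLower.trunc_gram {U V : SMat} (hU : BlockLower U) (hV : BlockLower V) (Y : SMat)
    (K : ℕ) : trunc (2 * K) (U ⋅ₘ Y ⋅ₘ V.transpose) =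
      trunc (2 * K) U * trunc (2 * K) Y * (trunc (2 * K) V).transpose := by
  rw [← hU.trunc_mul]
  have : U ⋅ₘ Y ⋅ₘ V.transpose = (V ⋅ₘ (U ⋅ₘ Y).transpose).transpose := by
    rw [matMul_transpose, Matrix.transpose_transpose]
  rw [this]
  change (trunc (2 * K) (V ⋅ₘ (U ⋅ₘ Y).transpose)).transpose = _
  rw [hV.trunc_mul, Matrix.transpose_mul]
  rfl

/-- The ratio `h_k` of consecutive Pfaffians of the moment matrix. -/
noncomputable def pfRatio (M : SMat) (k : ℕ) : ℂ :=
  pf (k + 1) (trunc (2 * (k + 1)) M) / pf k (trunc (2 * k) M)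

/-- `P M Pᵀ = J h`, locally in the indices. -/
theorem gram_skewCoeff {M : SMat} (hskew : ∀ k l, M k l = -M l k) {K : ℕ}
    (hpf : ∀ k ≤ K, pf k (trunc (2 * k) M) ≠ 0) {i j : ℕ} (hi : i / 2 ≤ K) (hj : j / 2 ≤ K) :
    (skewCoeff M ⋅ₘ M ⋅ₘ (skewCoeff M).transpose) i j = jDiag (pfRatio M) i j := by
  set P := skewCoeff M with hP
  set G := P ⋅ₘ M ⋅ₘ P.transpose with hG
  have hPl : BlockLower P := blockLower_skewCoeff M
  have hdet : ∀ k ≤ K, (trunc (2 * k) M).det ≠ 0 := fun k hk =>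
    det_ne_zero_of_pf_ne_zero k _ (trunc_transpose hskew _) (hpf k hk)
  have hGskew : ∀ i j, G i j = -G j i := hPl.gram_skew hPl hskew
  have hlower : ∀ i j, i / 2 ≤ K → j / 2 < i / 2 → G i j = 0 := by
    intro i j hi hij
    rw [hG, ← Matrix.transpose_apply (P ⋅ₘ M ⋅ₘ P.transpose), matMul_transpose,
      Matrix.transpose_transpose,
      matMul_eq_sum (N := 2 * (j / 2) + 2) (fun k hk => hPl _ _ (by omega))]
    refine Finset.sum_eq_zero fun l hl => ?_
    have := Finset.mem_range.mp hl
    rw [Matrix.transpose_apply, skewCoeff_matMul_eq_zero M (hdet _ hi) (by omega), mul_zero]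
  have hGJ : ∀ i j, i / 2 ≤ K → j / 2 ≤ K →
      G i j = jDiag (fun k => G (2 * k) (2 * k + 1)) i j := by
    intro i j hi hj
    rw [jDiag_apply]
    rcases lt_trichotomy (i / 2) (j / 2) with h | h | h
    · rw [hGskew, hlower j i hj h, if_neg, neg_zero]
      rintro rfl
      rw [partner_div] at h
      omega
    · have hself : ∀ i, G i i = 0 := fun i => self_eq_neg.mp (hGskew i i)
      rcases Nat.mod_two_eq_zero_or_one i with hi2 | hi2 <;>
        rcases Nat.mod_two_eq_zero_or_one j with hj2 | hj2
      · obtain rfl : i = j := by omega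
        rw [hself, if_neg (by unfold partner; grind)]
      · obtain rfl : j = i + 1 := by omega
        rw [if_pos (by unfold partner; grind), show 2 * (i / 2) = i by omega]
        simp [jSign, hi2]
      · obtain rfl : i = j + 1 := by omega
        rw [if_pos (by unfold partner; grind), hGskew, show 2 * ((j + 1) / 2) = j by omega]
        simp [jSign, hi2]
      · obtain rfl : i = j := by omega
        rw [hself, if_neg (by unfold partner; grind)]
    · rw [hlower i j hi h, if_neg]
      rintro rfl
      rw [partner_div] at h
      omega
  -- Congruence by the unipotent `P` preserves every leading Pfaffian. The size `m = K + 1` is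
  -- allowed, as it meets only blocks with index at most `K`; thus the Pfaffian of order `K + 1`
  -- need not be nonzero.
  have hprod : ∀ m ≤ K + 1, pf m (trunc (2 * m) M) =
      ∏ k ∈ Finset.range m, G (2 * k) (2 * k + 1) := by
    intro m hm
    have h1 : trunc (2 * m) G =
        Matrix.of fun i j : Fin (2 * m) => J i j * G (2 * (j / 2)) (2 * (j / 2) + 1) := by
      ext i j
      rw [trunc_apply, hGJ i j (by omega) (by omega), jDiag, matMul_doubleDiag]
      rfl
    rw [← pf_J_mul m fun k => G (2 * k) (2 * k + 1), ← h1, hG, hPl.trunc_gram hPl, pf_congruence,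
      det_trunc_skewCoeff, one_mul]
  have hratio : ∀ k ≤ K, G (2 * k) (2 * k + 1) = pfRatio M k := by
    intro k hk
    have h0 := hpf k hk
    rw [pfRatio, eq_div_iff h0, hprod (k + 1) (by omega), hprod k (by omega),
      Finset.prod_range_succ, mul_comm]
  rw [hGJ i j hi hj, jDiag_apply, jDiag_apply, hratio _ hi]

/-! ### The decomposition when every leading Pfaffian is nonzero -/

section Global

variable {M : SMat}

theorem gram_skewCoeff_eq (hskew : ∀ k l, M k l = -M l k)
    (hpf : ∀ k, pf k (trunc (2 * k) M) ≠ 0) :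
    skewCoeff M ⋅ₘ M ⋅ₘ (skewCoeff M).transpose = jDiag (pfRatio M) := by
  ext i j
  exact gram_skewCoeff hskew (K := max (i / 2) (j / 2)) (fun k _ => hpf k) (le_max_left _ _)
    (le_max_right _ _)

theorem pfRatio_ne_zero (hpf : ∀ k, pf k (trunc (2 * k) M) ≠ 0) (k : ℕ) : pfRatio M k ≠ 0 :=
  div_ne_zero (hpf _) (hpf _)

/-- From `P M Pᵀ = J h` the inverse of `P` must be `M Pᵀ (J h)⁻¹`. It is block lower triangular
because, up to sign, `M Pᵀ` is the transpose of `P M`, whose blocks below the diagonal vanish by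
orthogonality. -/
theorem exists_inverse_skewCoeff (hskew : ∀ k l, M k l = -M l k)
    (hpf : ∀ k, pf k (trunc (2 * k) M) ≠ 0) :
    BlockLower (blockInv (skewCoeff M)) ∧ skewCoeff M ⋅ₘ blockInv (skewCoeff M) = 1 ∧
      blockInv (skewCoeff M) ⋅ₘ skewCoeff M = 1 := by
  set P := skewCoeff M with hP
  set K := -jDiag fun k => (pfRatio M k)⁻¹ with hK
  have hPl : BlockLower P := blockLower_skewCoeff M
  have hKl : BlockLower K := fun i j hij => by
    rw [hK, Matrix.neg_apply, blockLower_jDiag _ i j hij, neg_zero]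
  have hKt : RowFinite K.transpose := by
    rw [hK, Matrix.transpose_neg, jDiag_transpose, neg_neg]
    exact (blockLower_jDiag _).rowFinite
  have hMP : BlockLower (M ⋅ₘ P.transpose) := by
    intro i j hij
    have h1 : (M ⋅ₘ P.transpose) i j = (P ⋅ₘ M.transpose) j i := by
      rw [← Matrix.transpose_apply (P ⋅ₘ M.transpose), matMul_transpose, Matrix.transpose_transpose]
    have h2 : M.transpose = -M := by ext k l; exact hskew l k
    rw [h1, h2, matMul_neg, Matrix.neg_apply, skewCoeff_matMul_eq_zero M ?_ (by omega), neg_zero]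
    exact det_ne_zero_of_pf_ne_zero _ _ (trunc_transpose hskew _) (hpf _)
  have hBl : BlockLower (M ⋅ₘ P.transpose ⋅ₘ K) := hMP.mul hKl
  have hPB : P ⋅ₘ (M ⋅ₘ P.transpose ⋅ₘ K) = 1 := by
    rw [← matMul_assoc' hPl.rowFinite hKt, ← matMul_assoc' hPl.rowFinite
      (by rw [Matrix.transpose_transpose]; exact hPl.rowFinite), gram_skewCoeff_eq hskew hpf]
    exact jDiag_mul_inv _ (pfRatio_ne_zero hpf)
  rw [hPl.blockInv_eq hPB]
  exact ⟨hBl, hPB, hPl.matMul_eq_one_comm hBl hPB⟩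

end Global

/-! ### Shifts and the dressed shift -/

theorem matMul_shiftMat (A : SMat) (i k : ℕ) :
    (A ⋅ₘ shiftMat) i k = if k = 0 then 0 else A i (k - 1) := by
  rw [matMul_eq_single (k - 1)]
  · unfold shiftMat
    split_ifs <;> first | omega | simp
  · intro l hl
    unfold shiftMat
    rw [if_neg (by omega), mul_zero]

theorem matPow_shiftMat_apply (n i j : ℕ) :
    matPow shiftMat n i j = if j = i + n then 1 else 0 := by
  induction n generalizing j with
  | zero => simp [matPow, Matrix.one_apply, eq_comm]
  | succ n ih =>
    rw [matPow, matMul_shiftMat]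
    split_ifs with h1 h2 h2
    · omega
    · rfl
    · rw [ih, if_pos (by omega)]
    · rw [ih, if_neg (by omega)]

theorem matPow_shiftMat_matMul (n : ℕ) (A : SMat) (i j : ℕ) :
    (matPow shiftMat n ⋅ₘ A) i j = A (i + n) j := by
  rw [matMul_eq_single (i + n) fun l hl => by rw [matPow_shiftMat_apply, if_neg hl, zero_mul],
    matPow_shiftMat_apply, if_pos rfl, one_mul]

theorem rowFinite_shiftMat : RowFinite shiftMat := fun i =>
  ⟨i + 2, fun k hk => if_neg (by omega)⟩

/-- `P Λ P⁻¹`. -/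
noncomputable def dressedShift (P : SMat) : SMat := P ⋅ₘ shiftMat ⋅ₘ blockInv P

theorem dressedShift_matPow {P : SMat} (hP : RowFinite P) (hQ : RowFinite (blockInv P))
    (hPQ : P ⋅ₘ blockInv P = 1) (hQP : blockInv P ⋅ₘ P = 1) (n : ℕ) :
    matPow (dressedShift P) n = P ⋅ₘ matPow shiftMat n ⋅ₘ blockInv P := by
  induction n with
  | zero => rw [matPow, matPow, matMul_one, hPQ]
  | succ n ih =>
    have hS := rowFinite_shiftMat.matPow n
    rw [matPow, ih, matPow, dressedShift, matMul_assoc (hP.mul hS) hQ,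
      ← matMul_assoc hQ (hP.mul rowFinite_shiftMat), ← matMul_assoc hQ hP, hQP, one_matMul,
      ← matMul_assoc (hP.mul hS) rowFinite_shiftMat, matMul_assoc hP hS]

/-- An entry of the dressed shift involves one row of `P` and finitely many truncated inverses.
Hence an identity known only for finitely many rows of `P`, which is all that holds near `t`,
suffices for each entry. -/
theorem dressedShift_congr {A B : SMat} (hB : BlockLower B) (i j N : ℕ) (hN : i + j + 6 ≤ N)
    (h : ∀ k < N, ∀ l, A k l = B k l) : dressedShift A i j = dressedShift B i j := by
  have hrow : ∀ k, i + 4 ≤ k → (B ⋅ₘ shiftMat) i k = 0 := fun k hk => by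
    rw [matMul_shiftMat, if_neg (by omega), hB _ _ (by omega)]
  have hAB : ∀ k, (A ⋅ₘ shiftMat) i k = (B ⋅ₘ shiftMat) i k := fun k => by
    rw [matMul_shiftMat, matMul_shiftMat, h i (by omega)]
  rw [dressedShift, dressedShift, matMul_eq_sum (N := i + 4) (fun k hk => by rw [hAB, hrow k hk]),
    matMul_eq_sum hrow]
  refine Finset.sum_congr rfl fun k hk => ?_
  have := Finset.mem_range.mp hk
  have htr : trunc (2 * (max (k / 2) (j / 2) + 1)) A = trunc (2 * (max (k / 2) (j / 2) + 1)) B := by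
    ext a b
    exact h a (by have := a.2; omega) b
  rw [hAB, blockInv_apply, blockInv_apply, htr]

/-! ### The flow of the dressed shift -/

theorem hasDerivAt_blockInv {P : ℂ → SMat} {P' Q : SMat} (hP : BlockLower (P 0))
    (hP' : BlockLower P') (hQ : BlockLower Q) (hPQ : P 0 ⋅ₘ Q = 1)
    (hder : ∀ i j, HasDerivAt (fun a => P a i j) (P' i j) 0) (i j : ℕ) :
    HasDerivAt (fun a => blockInv (P a) i j) ((-(Q ⋅ₘ P' ⋅ₘ Q)) i j) 0 := by
  set K := max (i / 2) (j / 2) + 1 with hK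
  have h1 : trunc (2 * K) (P 0) * trunc (2 * K) Q = 1 := by
    rw [← hP.trunc_mul, hPQ, trunc_one]
  have h2 : (trunc (2 * K) (P 0))⁻¹ = trunc (2 * K) Q := Matrix.inv_eq_right_inv h1
  have h3 : (trunc (2 * K) (P 0)).det ≠ 0 := Matrix.det_ne_zero_of_right_inverse h1
  have h4 := hasDerivAt_inv_apply (A := fun a => trunc (2 * K) (P a)) (A' := trunc (2 * K) P')
    (fun a b => hder a b) h3 ⟨i, by omega⟩ ⟨j, by omega⟩
  rw [h2, ← hQ.trunc_mul, ← (hQ.mul hP').trunc_mul] at h4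
  exact h4

/-- With `Q = P⁻¹`, the derivative of `P Λ Q` is `P' Λ Q - P Λ Q P' Q`, which is `[P' Q, P Λ Q]`
after inserting `Q P = 1`. -/
theorem hasDerivAt_dressedShift {P : ℂ → SMat} {P' : SMat} (hP : ∀ a, BlockLower (P a))
    (hP' : BlockLower P') (hQ : BlockLower (blockInv (P 0))) (hPQ : P 0 ⋅ₘ blockInv (P 0) = 1)
    (hQP : blockInv (P 0) ⋅ₘ P 0 = 1)
    (hder : ∀ i j, HasDerivAt (fun a => P a i j) (P' i j) 0) (i j : ℕ) :
    HasDerivAt (fun a => dressedShift (P a) i j)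
      (bracket (P' ⋅ₘ blockInv (P 0)) (dressedShift (P 0)) i j) 0 := by
  set Q := blockInv (P 0) with hQdef
  have hrow : ∀ {A : SMat}, BlockLower A → ∀ k, i + 4 ≤ k → (A ⋅ₘ shiftMat) i k = 0 := by
    intro A hA k hk
    rw [matMul_shiftMat, if_neg (by omega), hA _ _ (by omega)]
  have h1 : HasDerivAt (fun a => ∑ k ∈ Finset.range (i + 4),
      (P a ⋅ₘ shiftMat) i k * blockInv (P a) k j)
      (∑ k ∈ Finset.range (i + 4), ((P' ⋅ₘ shiftMat) i k * Q k j +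
        (P 0 ⋅ₘ shiftMat) i k * (-(Q ⋅ₘ P' ⋅ₘ Q)) k j)) 0 := by
    refine HasDerivAt.fun_sum fun k _ => ?_
    refine HasDerivAt.mul ?_ (hasDerivAt_blockInv (hP 0) hP' hQ hPQ hder k j)
    simp only [matMul_shiftMat]
    split_ifs
    · exact hasDerivAt_const _ _
    · exact hder _ _
  have hPf := (hP 0).rowFinite
  have hP'f := hP'.rowFinite
  have hQf := hQ.rowFinite
  have hS := rowFinite_shiftMat
  have h2 : bracket (P' ⋅ₘ Q) (dressedShift (P 0)) =
      P' ⋅ₘ shiftMat ⋅ₘ Q + P 0 ⋅ₘ shiftMat ⋅ₘ (-(Q ⋅ₘ P' ⋅ₘ Q)) := by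
    rw [bracket, sub_eq_add_neg, dressedShift, ← hQdef, matMul_neg]
    congr 1
    · rw [matMul_assoc hPf hS, matMul_assoc hP'f hQf, ← matMul_assoc hQf hPf, hQP, one_matMul,
        matMul_assoc hP'f hS]
    · rw [matMul_assoc (hPf.mul hS) hQf, ← matMul_assoc hQf hP'f]
  convert! h1 using 1
  · funext a
    rw [dressedShift, matMul_eq_sum (hrow (hP a))]
  · rw [h2, Matrix.add_apply, matMul_eq_sum (hrow hP'), matMul_eq_sum (hrow (hP 0)),
      ← Finset.sum_add_distrib]

section Flow

variable {M : ℂ → SMat} {n : ℕ}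

/-- The generator `-(Lⁿ)₋ - J h (Lⁿ)₊ᵀ (J h)⁻¹` of the flow. -/
noncomputable def flowGen (h : ℕ → ℂ) (B : SMat) : SMat :=
  -blockLower B - jDiag h ⋅ₘ (blockUpper B).transpose ⋅ₘ blockInv (jDiag h)

theorem flowGen_apply {h : ℕ → ℂ} (hh : ∀ k, h k ≠ 0) (B : SMat) (i j : ℕ) :
    flowGen h B i j = if j / 2 < i / 2 then
      -B i j - jSign i * jSign j * (h (i / 2) / h (j / 2)) * B (partner j) (partner i) else 0 := by
  rw [flowGen, Matrix.sub_apply, Matrix.neg_apply, jDiag_conj h hh, Matrix.transpose_apply]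
  unfold blockLower blockUpper
  rw [partner_div, partner_div]
  split_ifs <;> simp

/-- The differential equations satisfied by the skew Borel decomposition of a moment matrix with
`M' = Λⁿ M + M (Λⁿ)ᵀ`. -/
theorem skewBorel_flow (hskew : ∀ a k l, M a k l = -M a l k)
    (hpf : ∀ k, pf k (trunc (2 * k) (M 0)) ≠ 0)
    (hM : ∀ k l, HasDerivAt (fun a => M a k l) (M 0 (k + n) l + M 0 k (l + n)) 0) :
    (∀ i j, HasDerivAt (fun a => dressedShift (skewCoeff (M a)) i j)
      (bracket (flowGen (pfRatio (M 0)) (matPow (dressedShift (skewCoeff (M 0))) n))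
        (dressedShift (skewCoeff (M 0))) i j) 0) ∧
    ∀ k, HasDerivAt (fun a => pfRatio (M a) k) (pfRatio (M 0) k *
      (matPow (dressedShift (skewCoeff (M 0))) n (2 * k) (2 * k) +
        matPow (dressedShift (skewCoeff (M 0))) n (2 * k + 1) (2 * k + 1))) 0 := by
  set P := skewCoeff (M 0) with hP
  set Q := blockInv P with hQdef
  set h := pfRatio (M 0) with hh
  set B := matPow (dressedShift P) n with hB
  have hh0 : ∀ k, h k ≠ 0 := pfRatio_ne_zero hpf
  have hPl : BlockLower P := blockLower_skewCoeff _
  obtain ⟨hQl, hPQ, hQP⟩ : BlockLower Q ∧ P ⋅ₘ Q = 1 ∧ Q ⋅ₘ P = 1 :=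
    exists_inverse_skewCoeff (hskew 0) hpf
  have hdet : ∀ k, (trunc (2 * k) (M 0)).det ≠ 0 := fun k =>
    det_ne_zero_of_pf_ne_zero k _ (trunc_transpose (hskew 0) _) (hpf k)
  have hMd : ∀ k l, DifferentiableAt ℂ (fun a => M a k l) 0 := fun k l => (hM k l).differentiableAt
  set P' : SMat := fun i j => deriv (fun a => skewCoeff (M a) i j) 0 with hP'
  have hPder : ∀ i j, HasDerivAt (fun a => skewCoeff (M a) i j) (P' i j) 0 := fun i j =>
    (differentiableAt_skewCoeff hMd i (hdet _) j).hasDerivAt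
  have hP'0 : ∀ i j, i / 2 ≤ j / 2 → P' i j = 0 := by
    intro i j hij
    have : (fun a => skewCoeff (M a) i j) = fun _ => (1 : SMat) i j :=
      funext fun a => skewCoeff_of_le _ (by omega)
    simp only [hP']
    rw [this, deriv_const]
  have hP'l : BlockLower P' := fun i j hij => hP'0 i j hij.le
  have hpfd : ∀ k, DifferentiableAt ℂ (fun a => pf k (trunc (2 * k) (M a))) 0 := fun k =>
    differentiableAt_pf k (A := fun a => trunc (2 * k) (M a)) fun i j => hMd i j
  have hpfe : ∀ k, ∀ᶠ a in 𝓝 (0 : ℂ), pf k (trunc (2 * k) (M a)) ≠ 0 := fun k =>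
    (hpfd k).continuousAt.eventually_ne (hpf k)
  have hhd : ∀ k, DifferentiableAt ℂ (fun a => pfRatio (M a) k) 0 := fun k =>
    (hpfd (k + 1)).div (hpfd k) (hpf k)
  set h' : ℕ → ℂ := fun k => deriv (fun a => pfRatio (M a) k) 0 with hh'
  have hhder : ∀ k, HasDerivAt (fun a => pfRatio (M a) k) (h' k) 0 := fun k => (hhd k).hasDerivAt
  set A := P' ⋅ₘ Q with hA
  -- The diagonal blocks of `P` are constant, so `P'`, and with it `P' Q`, is strictly block lower
  -- triangular.
  have hA0 : ∀ i j, i / 2 ≤ j / 2 → A i j = 0 := by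
    intro i j hij
    rw [hA, matMul_eq_sum (N := 2 * (i / 2) + 2) (fun k hk => hP'0 _ _ (by omega))]
    refine Finset.sum_eq_zero fun k _ => ?_
    by_cases hk : i / 2 ≤ k / 2
    · rw [hP'0 i k hk, zero_mul]
    · rw [hQl k j (by omega), mul_zero]
  have hS : RowFinite (matPow shiftMat n) := rowFinite_shiftMat.matPow n
  have hBeq : B = P ⋅ₘ matPow shiftMat n ⋅ₘ Q :=
    dressedShift_matPow hPl.rowFinite hQl.rowFinite hPQ hQP n
  have hG : P ⋅ₘ M 0 ⋅ₘ P.transpose = jDiag h := gram_skewCoeff_eq (hskew 0) hpf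
  have hPt : RowFinite P.transpose.transpose := by
    rw [Matrix.transpose_transpose]; exact hPl.rowFinite
  -- This is `Q J h = M Pᵀ`, used to trade the inverse of `P` for moments.
  have hXQ : ∀ X : SMat, RowFinite X → X ⋅ₘ Q ⋅ₘ jDiag h = X ⋅ₘ M 0 ⋅ₘ P.transpose := by
    intro X hX
    rw [← hG, ← matMul_assoc' (hX.mul hQl.rowFinite) hPt,
      ← matMul_assoc (hX.mul hQl.rowFinite) hPl.rowFinite, matMul_assoc hX hQl.rowFinite,
      hQP, matMul_one]
  have hX1 : P' ⋅ₘ M 0 ⋅ₘ P.transpose = A ⋅ₘ jDiag h := (hXQ P' hP'l.rowFinite).symm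
  have hX2 : P ⋅ₘ (fun k l => M 0 (k + n) l : SMat) ⋅ₘ P.transpose = B ⋅ₘ jDiag h := by
    rw [hBeq, hXQ _ (hPl.rowFinite.mul hS), matMul_assoc hPl.rowFinite hS]
    congr 2
    ext k l
    rw [matPow_shiftMat_matMul]
  have hX3 : ∀ i j, (P ⋅ₘ (fun k l => M 0 k (l + n) : SMat) ⋅ₘ P.transpose) i j =
      -(B ⋅ₘ jDiag h) j i := by
    intro i j
    rw [← hX2]
    exact hPl.gram_skew hPl (fun k l => hskew 0 _ _) i j
  have hX4 : ∀ i j, (P ⋅ₘ M 0 ⋅ₘ P'.transpose) i j = -(A ⋅ₘ jDiag h) j i := by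
    intro i j
    rw [← hX1]
    exact hPl.gram_skew hP'l (hskew 0) i j
  -- The derivative of `P M Pᵀ = J h`. The terms from the right-hand factors are the negative
  -- transposes of those from the left, by skewness of `M`.
  have hE : ∀ i j, (A ⋅ₘ jDiag h) i j + (B ⋅ₘ jDiag h) i j - (B ⋅ₘ jDiag h) j i -
      (A ⋅ₘ jDiag h) j i = jDiag h' i j := by
    intro i j
    set N := i + j + 2 with hN
    have h1 : HasDerivAt (fun a => ∑ l ∈ Finset.range N, ∑ k ∈ Finset.range N,
        skewCoeff (M a) i k * M a k l * skewCoeff (M a) j l)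
        (∑ l ∈ Finset.range N, ∑ k ∈ Finset.range N,
          ((P' i k * M 0 k l + P i k * (M 0 (k + n) l + M 0 k (l + n))) * P j l +
            P i k * M 0 k l * P' j l)) 0 :=
      HasDerivAt.fun_sum fun l _ => HasDerivAt.fun_sum fun k _ =>
        ((hPder i k).mul (hM k l)).mul (hPder j l)
    have h2 : (fun a => ∑ l ∈ Finset.range N, ∑ k ∈ Finset.range N,
        skewCoeff (M a) i k * M a k l * skewCoeff (M a) j l) =ᶠ[𝓝 0]
        fun a => jDiag (pfRatio (M a)) i j := by
      -- For fixed `i, j` only the Pfaffians of order below `N` matter, so a common neighbourhood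
      -- exists.
      have hev : ∀ᶠ a in 𝓝 (0 : ℂ), ∀ k ∈ Finset.range N, pf k (trunc (2 * k) (M a)) ≠ 0 :=
        (Filter.eventually_all_finset _).mpr fun k _ => hpfe k
      filter_upwards [hev] with a ha
      rw [← gram_skewCoeff (hskew a) (K := i + j + 1)
        (fun k hk => ha k (Finset.mem_range.mpr (by omega))) (by omega) (by omega)]
      exact ((blockLower_skewCoeff _).gram_apply (blockLower_skewCoeff _) _ (by omega)
        (by omega)).symm
    have h3 : HasDerivAt (fun a => jDiag (pfRatio (M a)) i j) (jDiag h' i j) 0 := by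
      simp only [jDiag_apply]
      split_ifs
      · exact (hhder _).const_mul _
      · exact hasDerivAt_const _ _
    have h4 := h3.unique (h1.congr_of_eventuallyEq h2.symm)
    have hi : 2 * (i / 2) + 2 ≤ N := by omega
    have hj : 2 * (j / 2) + 2 ≤ N := by omega
    have e1 := (congrFun (congrFun hX1.symm i) j).trans (hP'l.gram_apply hPl _ hi hj)
    have e2 := (congrFun (congrFun hX2.symm i) j).trans (hPl.gram_apply hPl _ hi hj)
    have e3 := (hX3 i j).symm.trans (hPl.gram_apply hPl _ hi hj)
    have e4 := (hX4 i j).symm.trans (hPl.gram_apply hP'l _ hi hj)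
    rw [h4, sub_eq_add_neg, sub_eq_add_neg, e1, e2, e3, e4]
    simp only [← Finset.sum_add_distrib]
    exact Finset.sum_congr rfl fun l _ => Finset.sum_congr rfl fun k _ => by ring
  have hE' : ∀ i j, -(A i (partner j) + B i (partner j)) * (jSign j * h (j / 2)) +
      (A j (partner i) + B j (partner i)) * (jSign i * h (i / 2)) = jDiag h' i j := by
    intro i j
    rw [← hE i j, matMul_jDiag, matMul_jDiag, matMul_jDiag, matMul_jDiag]
    ring
  have hAval : A = flowGen h B := by
    ext i j
    rw [flowGen_apply hh0]
    split_ifs with hij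
    · have h1 := hE' i (partner j)
      rw [partner_partner, partner_div, jSign_partner, jDiag_apply, if_neg,
        hA0 (partner j) (partner i) (by rw [partner_div, partner_div]; omega)] at h1
      · have hhj := hh0 (j / 2)
        have hs := jSign_mul_self j
        have h2 : (A i j + B i j) * h (j / 2) =
            -(jSign i * jSign j * h (i / 2) * B (partner j) (partner i)) := by
          linear_combination jSign j * h1 - (A i j + B i j) * h (j / 2) * hs
        field_simp
        linear_combination h2
      · intro hc
        have := congrArg partner hc
        rw [partner_partner, partner_partner] at this
        omega
    · exact hA0 i j (by omega)
  have hhval : ∀ k, h' k = h k * (B (2 * k) (2 * k) + B (2 * k + 1) (2 * k + 1)) := by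
    intro k
    -- In a diagonal block both entries of `A` vanish, leaving `h'` in terms of `B` alone.
    have h1 := hE' (2 * k) (2 * k + 1)
    have hp1 : partner (2 * k) = 2 * k + 1 := by unfold partner; grind
    have hp2 : partner (2 * k + 1) = 2 * k := by unfold partner; grind
    have hs1 : jSign (2 * k) = 1 := if_pos (by omega)
    have hs2 : jSign (2 * k + 1) = -1 := if_neg (by omega)
    rw [hp2, hp1, hA0 _ _ le_rfl, hA0 _ _ le_rfl, jDiag_apply, hp1, if_pos rfl, hs1, hs2,
      show 2 * k / 2 = k by omega, show (2 * k + 1) / 2 = k by omega] at h1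
    linear_combination -h1
  refine ⟨fun i j => ?_, fun k => ?_⟩
  · rw [← hAval]
    exact hasDerivAt_dressedShift (P := fun a => skewCoeff (M a))
      (fun a => blockLower_skewCoeff _) hP'l hQl hPQ hQP hPder i j
  · rw [← hhval]
    exact hhder k

end Flow

/-! ### The symmetric form of the lattice -/

/-- The slope of `r` is the slope of `h` divided by `r a + r 0`, so continuity of the chosen root is
enough. -/
theorem hasDerivAt_of_sq_eq {r h : ℂ → ℂ} {d : ℂ} (hr : ∀ a, r a ^ 2 = h a)
    (hc : ContinuousAt r 0) (hh : HasDerivAt h d 0) (h0 : h 0 ≠ 0) :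
    HasDerivAt r (d / (2 * r 0)) 0 := by
  have hr0 : r 0 ≠ 0 := fun h => h0 (by rw [← hr, h]; ring)
  rw [hasDerivAt_iff_tendsto_slope] at hh ⊢
  have hsum : Tendsto (fun a => r a + r 0) (𝓝[≠] 0) (𝓝 (2 * r 0)) := by
    have := (hc.tendsto.mono_left nhdsWithin_le_nhds).add_const (r 0)
      (f := fun a => r a) (x := 𝓝[≠] (0 : ℂ))
    rwa [← two_mul] at this
  have h2 : (2 : ℂ) * r 0 ≠ 0 := mul_ne_zero two_ne_zero hr0
  refine (hh.div hsum h2).congr' ?_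
  filter_upwards [hsum.eventually_ne h2] with a ha
  rw [Pi.div_apply, slope_def_field, slope_def_field, ← hr, ← hr]
  field_simp
  ring

theorem bracket_doubleDiag (d : ℕ → ℂ) (A : SMat) (i j : ℕ) :
    bracket (doubleDiag d) A i j = (d (i / 2) - d (j / 2)) * A i j := by
  rw [bracket, Matrix.sub_apply, doubleDiag_matMul, matMul_doubleDiag]
  ring

theorem bracket_add {A B C : SMat} (hA : RowFinite A) (hB : RowFinite B) (hC : RowFinite C) :
    bracket (A + B) C = bracket A C + bracket B C := by
  rw [bracket, bracket, bracket, add_matMul hA hB, matMul_add hC]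
  abel

theorem diagConj_bracket {r : ℕ → ℂ} (hr : ∀ k, r k ≠ 0) (A B : SMat) :
    diagConj r (bracket A B) = bracket (diagConj r A) (diagConj r B) := by
  rw [bracket, bracket, ← diagConj_matMul r hr, ← diagConj_matMul r hr]
  ext i j
  simp only [diagConj, Matrix.sub_apply]
  ring

/-- Conjugation turns the factor `h_i / h_j` into `r_i / r_j`, exactly the factor acquired by the
transposed entry. The sign of the second term changes because `J⁻¹ = -J`. -/
theorem diagConj_flowGen {r h : ℕ → ℂ} (hr : ∀ k, r k ^ 2 = h k) (hh : ∀ k, h k ≠ 0) (B : SMat) :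
    diagConj r (flowGen h B) =
      -blockLower (diagConj r B) + J ⋅ₘ (blockUpper (diagConj r B)).transpose ⋅ₘ J := by
  have hr0 : ∀ k, r k ≠ 0 := fun k h => hh k (by rw [← hr, h]; ring)
  ext i j
  rw [← jDiag_one, Matrix.add_apply, Matrix.neg_apply, matMul_jDiag, jDiag_matMul,
    Matrix.transpose_apply]
  simp only [diagConj, blockLower, blockUpper, partner_div, flowGen_apply hh, ← hr]
  have hi := hr0 (i / 2)
  have hj := hr0 (j / 2)
  split_ifs
  · field_simp
    ring
  · simp

theorem blockLower_flowGen {h : ℕ → ℂ} (hh : ∀ k, h k ≠ 0) (B : SMat) :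
    BlockLower (flowGen h B) := fun i j hij => by
  rw [flowGen_apply hh, if_neg (by omega)]

theorem rowFinite_doubleDiag (d : ℕ → ℂ) : RowFinite (doubleDiag d) := fun i =>
  ⟨i + 1, fun k hk => Matrix.diagonal_apply_ne _ (by omega)⟩

theorem blockTrace_diagConj {r : ℕ → ℂ} (hr : ∀ k, r k ≠ 0) (B : SMat) :
    blockTrace (diagConj r B) = blockTrace B := by
  have h : ∀ i j, i / 2 = j / 2 → diagConj r B i j = B i j := by
    intro i j hij
    have := hr (j / 2)
    rw [diagConj, hij]
    field_simp
  rw [blockTrace, blockTrace]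
  congr 1
  funext i
  rw [h _ _ rfl, h _ _ rfl]

theorem neg_half_blockTrace (B : SMat) : -((1 / 2 : ℂ) • blockTrace B) =
    doubleDiag fun k => -(1 / 2) * (B (2 * k) (2 * k) + B (2 * k + 1) (2 * k + 1)) := by
  ext i j
  by_cases h : i = j
  · subst h
    simp [blockTrace, doubleDiag]
  · simp [blockTrace, doubleDiag, h]

end PfaffToda

/-! ### The two forms of the Pfaffian Toda lattice -/

theorem theorem3p2 (F : ℝ → ℝ → ℂ) (hF : ∀ x y, F y x = -F x y) (n : ℕ+) (t : Times)
    (hconv : ∀ᶠ a : ℂ × ℂ in 𝓝 0,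
      Converges F (t + Pi.single 1 a.1 + Pi.single n a.2)
        (-(t + Pi.single 1 a.1 + Pi.single n a.2)))
    (hτ : ∀ k, tau F k t ≠ 0) :
    (∀ i j : ℕ, HasDerivAt (fun a : ℂ => LTilde F (t + Pi.single n a) i j)
      (bracket
        (-blockLower (matPow (LTilde F t) n)
          - JTilde F t ⋅ₘ (blockUpper (matPow (LTilde F t) n)).transpose ⋅ₘ blockInv (JTilde F t))
        (LTilde F t) i j) 0) ∧
    (∀ r : ℕ → Times → ℂ, (∀ k s, r k s ^ 2 = hTilde F k s) →
      (∀ k, ContinuousAt (fun a : ℂ => r k (t + Pi.single n a)) 0) →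
      ∀ i j : ℕ, HasDerivAt (fun a : ℂ => LSym F r (t + Pi.single n a) i j)
        (bracket
          (-((1 / 2 : ℂ) • blockTrace (matPow (LSym F r t) n))
            - blockLower (matPow (LSym F r t) n)
            + J ⋅ₘ (blockUpper (matPow (LSym F r t) n)).transpose ⋅ₘ J)
          (LSym F r t) i j) 0) := by
  set T : ℂ → Times := fun a => t + Pi.single n a with hT
  have hT0 : T 0 = t := by simp [hT]
  -- The odd polynomials contain a `t₁` derivative at every nearby value of `t_n`, so convergence is
  -- needed jointly in both times.
  have hev : ∀ᶠ a in 𝓝 (0 : ℂ), ∀ᶠ b in 𝓝 (0 : ℂ),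
      Converges F (T a + (Pi.single 1 b : Times)) (-(T a + (Pi.single 1 b : Times))) := by
    rw [show (0 : ℂ × ℂ) = (0, 0) from rfl, nhds_prod_eq] at hconv
    have := (Filter.eventually_swap_iff.mp hconv).curry
    filter_upwards [this] with a ha
    filter_upwards [ha] with b hb
    rwa [add_right_comm] at hb
  have hdir1 : ∀ᶠ a in 𝓝 (0 : ℂ), ∀ k l,
      HasDerivAt (fun b : ℂ => momentMat F (T a + (Pi.single 1 b : Times)) k l)
        (momentMat F (T a) (k + 1) l + momentMat F (T a) k (l + 1)) 0 :=
    hev.mono fun a ha k l => hasDerivAt_moment F (T a) 1 ha k l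
  have hdirn : ∀ k l, HasDerivAt (fun a : ℂ => momentMat F (T a) k l)
      (momentMat F (T 0) (k + n) l + momentMat F (T 0) k (l + n)) 0 := by
    rw [hT0]
    refine fun k l => hasDerivAt_moment F t n (hev.mono fun a ha => ?_) k l
    have := ha.self_of_nhds
    rwa [Pi.single_zero, add_zero] at this
  have hpf : ∀ k, pf k (trunc (2 * k) (momentMat F (T 0))) ≠ 0 := by
    rw [hT0]; exact hτ
  have hτe : ∀ k, ∀ᶠ a in 𝓝 (0 : ℂ), tau F k (T a) ≠ 0 := fun k =>
    (differentiableAt_pf k (A := fun a => trunc (2 * k) (momentMat F (T a)))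
      fun i j => (hdirn i j).differentiableAt).continuousAt.eventually_ne (hpf k)
  have hrow : ∀ i, ∀ᶠ a in 𝓝 (0 : ℂ), ∀ j,
      PTilde F (T a) i j = skewCoeff (momentMat F (T a)) i j := fun i => by
    filter_upwards [hdir1, hτe (i / 2)] with a ha hτa
    exact PTilde_eq_skewCoeff hF hτa ha
  have hL : ∀ i j, ∀ᶠ a in 𝓝 (0 : ℂ),
      LTilde F (T a) i j = dressedShift (skewCoeff (momentMat F (T a))) i j := by
    intro i j
    have : ∀ᶠ a in 𝓝 (0 : ℂ), ∀ k ∈ Finset.range (i + j + 6), ∀ l,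
        PTilde F (T a) k l = skewCoeff (momentMat F (T a)) k l :=
      (Filter.eventually_all_finset _).mpr fun k _ => hrow k
    filter_upwards [this] with a ha
    exact dressedShift_congr (blockLower_skewCoeff _) i j _ le_rfl
      fun k hk => ha k (Finset.mem_range.mpr hk)
  have hL0 : LTilde F t = dressedShift (skewCoeff (momentMat F (T 0))) := by
    ext i j
    rw [← (hL i j).self_of_nhds, hT0]
  have hh0 : pfRatio (momentMat F (T 0)) = fun k => hTilde F k t := by
    rw [hT0]; rfl
  obtain ⟨hflow, hhflow⟩ := skewBorel_flow (M := fun a => momentMat F (T a))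
    (fun a => momentMat_skew hF (T a)) hpf hdirn
  rw [← hL0, hh0] at hflow
  have hgen : -blockLower (matPow (LTilde F t) n) - JTilde F t ⋅ₘ
      (blockUpper (matPow (LTilde F t) n)).transpose ⋅ₘ blockInv (JTilde F t) =
      flowGen (fun k => hTilde F k t) (matPow (LTilde F t) n) := rfl
  have hLder : ∀ i j, HasDerivAt (fun a => LTilde F (T a) i j)
      (bracket (flowGen (fun k => hTilde F k t) (matPow (LTilde F t) n)) (LTilde F t) i j) 0 :=
    fun i j => (hflow i j).congr_of_eventuallyEq (hL i j)
  refine ⟨fun i j => ?_, fun r hr hrc i j => ?_⟩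
  · rw [hgen]
    exact hLder i j
  · set L := LTilde F t with hLdef
    have hh : ∀ k, hTilde F k t ≠ 0 := fun k => div_ne_zero (hτ _) (hτ _)
    have hr0 : ∀ k, r k t ≠ 0 := fun k h => hh k (by rw [← hr, h]; ring)
    have hLSym : ∀ s, LSym F r s = diagConj (fun k => r k s) (LTilde F s) := by
      intro s
      ext i j
      rw [LSym, matMul_doubleDiag, doubleDiag_matMul]
      rfl
    have hpow : matPow (LSym F r t) n = diagConj (fun k => r k t) (matPow L n) := by
      rw [hLSym, diagConj_matPow _ hr0]
    set tr : ℕ → ℂ := fun k => matPow L n (2 * k) (2 * k) + matPow L n (2 * k + 1) (2 * k + 1)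
      with htr
    have hrder : ∀ k, HasDerivAt (fun a => r k (T a)) (r k t * tr k / 2) 0 := by
      intro k
      have h1 := hhflow k
      rw [← hL0, hh0] at h1
      have h2 := hasDerivAt_of_sq_eq (h := fun a => hTilde F k (T a)) (fun a => hr k (T a)) (hrc k)
        h1 (by rw [hT0]; exact hh k)
      rw [hT0] at h2
      change HasDerivAt _ (hTilde F k t * tr k / (2 * r k t)) 0 at h2
      convert! h2 using 1
      rw [← hr]
      have := hr0 k
      field_simp
    have hder := ((((hrder (i / 2)).fun_inv (by rw [hT0]; exact hr0 _)).fun_mul (hLder i j)).fun_mul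
      (hrder (j / 2)))
    have hLrow : RowFinite L := by
      rw [hL0]
      have hP := (blockLower_skewCoeff (momentMat F (T 0))).rowFinite
      exact (hP.mul rowFinite_shiftMat).mul
        (exists_inverse_skewCoeff (momentMat_skew hF _) hpf).1.rowFinite
    -- Since `r_k' = r_k tr_k / 2`, differentiating the outer factors `r_i⁻¹` and `r_j` contributes
    -- `-(tr_i - tr_j) / 2` times the entry: the commutator with a diagonal matrix.
    have hgenS : -((1 / 2 : ℂ) • blockTrace (matPow (LSym F r t) n))
        - blockLower (matPow (LSym F r t) n)
        + J ⋅ₘ (blockUpper (matPow (LSym F r t) n)).transpose ⋅ₘ J =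
        doubleDiag (fun k => -(1 / 2) * tr k) +
          diagConj (fun k => r k t) (flowGen (fun k => hTilde F k t) (matPow L n)) := by
      rw [diagConj_flowGen (fun k => hr k t) hh, ← hpow, sub_eq_add_neg, add_assoc]
      congr 1
      rw [hpow, blockTrace_diagConj hr0, neg_half_blockTrace]
    rw [hgenS, bracket_add (rowFinite_doubleDiag _)
      ((blockLower_flowGen hh _).rowFinite.diagConj _) (by rw [hLSym]; exact hLrow.diagConj _),
      Matrix.add_apply, bracket_doubleDiag, hLSym t, ← diagConj_bracket hr0]
    convert! hder using 1
    · funext a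
      rw [hLSym]
      rfl
    · simp only [hT0, diagConj]
      have := hr0 (i / 2)
      field_simp
      ring
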